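/- A \emph{$k$-input, $r$-prover verifier} $V$ is a randomized interactive Turing machine with $k$ input tapes, $r$ communication tapes, a workspace tape and an output tape. It alternates between computation phases (in which it may flip fair coins) and communication phases, in which prover $i$ reads the message on the $i$-th communication tape and replaces it by an answer in $\{0,1\}^*$; it halts by accepting or rejecting. Its running time $\mathsf{TIME}(V(x))$ on input $x$ is the maximal number of time steps before it halts, over all coin flips and all responses of the provers. A \emph{finite-dimensional strategy} $\mathcal S$ for $r$ provers consists of a dimension $d\ge 1$, a unit vector $|\psi\rangle\in(\mathbb C^d)^{\otimes r}$, and, for every prover $i$, every round $t$ and every history $\pi$ (the messages that prover $i$ has received and sent so far, including the verifier's message of round $t$), a POVM $\{M^a_{i,t,\pi}\}_{a\in\{0,1\}^*}$ on $\mathbb C^d$. In round $t$ prover $i$ measures its share of the current state with $\{M^a_{i,t,\pi}\}_a$ and answers with the outcome; outcomes $a_1,\dots,a_r$ change the shared state by applying $\bigotimes_i \sqrt{M^{a_i}_{i,t,\pi_i}}$ and normalizing. Let $\omega_q(V(x),\mathcal S)$ be the probability that $V$ on input $x$ halts and accepts, and $\omega_q(V(x))=\sup_{\mathcal S}\omega_q(V(x),\mathcal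 S)$, the supremum over all finite-dimensional strategies. Let $\mathsf{MIP}^*_0$ be the class of languages $L\subseteq\{0,1\}^*$ for which there are integers $m,r\ge 1$, a $1$-input, $r$-prover verifier $V$ and a polynomial $p$ such that for every $x\in\{0,1\}^*$: $V$ on input $x$ uses at most $m$ communication phases, $\mathsf{TIME}(V(x))\le p(|x|)$, and $x\in L$ if and only if $\omega_q(V(x))=1$. Let $\Pi^0_2$ be the class of languages of the form $\{x\in\{0,1\}^* : \forall y\in\mathbb N\ \exists z\in\mathbb N\ R(x,y,z)=1\}$ with a total computable $R$. \textbf{Theorem.} $\mathsf{MIP}^*_0\subseteq\Pi^0_2$. -/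

import Mathlib

open scoped ENNReal ComplexOrder MatrixOrder

/-! ### Tapes -/

/-- A one-way infinite tape with cells `0, 1, 2, …` over the alphabet consisting of a blank (`none`),
the two bits (`some (Sum.inl b)`) and further symbols from `A`. The list `cells` holds the contents of
the first cells, all cells beyond it are blank; `head` is the position of the head. -/
structure VTape (A : Type) where
  cells : List (Option (Bool ⊕ A))
  head : ℕ

/-- The possible head movements (at cell `0` a move to the left leaves the head in place). -/
inductive HeadMove where
  | left
  | right
  | stay

namespace VTape

variable {A : Type}

/-- The tape that contains the string `w`, with the head on cell `0`. -/
def ofString (w : List Bool) : VTape A where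
  cells := w.map fun b => some (Sum.inl b)
  head := 0

/-- The symbol under the head. -/
def read (t : VTape A) : Option (Bool ⊕ A) :=
  t.cells.getD t.head none

/-- Replace the symbol under the head by `a`. -/
def write (t : VTape A) (a : Option (Bool ⊕ A)) : VTape A where
  cells := (t.cells ++ List.replicate (t.head + 1 - t.cells.length) none).set t.head a
  head := t.head

/-- Move the head. -/
def move (t : VTape A) : HeadMove → VTape A
  | .left => ⟨t.cells, t.head - 1⟩
  | .right => ⟨t.cells, t.head + 1⟩
  | .stay => t

/-- The longest initial segment that consists of bits. -/
def bitPrefix : List (Option (Bool ⊕ A)) → List Bool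
  | some (Sum.inl b) :: l => b :: bitPrefix l
  | _ => []

/-- The string written on the tape: the bits from cell `0` up to the first cell without a bit. -/
def content (t : VTape A) : List Bool :=
  bitPrefix t.cells

end VTape

/-! ### Interactive verifiers -/

/-- The tapes of a `k`-input, `r`-prover verifier: `k` input tapes, `r` communication tapes,
a workspace tape and an output tape. -/
inductive TapeIndex (k r : ℕ) where
  | input (j : Fin k)
  | comm (i : Fin r)
  | work
  | output

/-- What a verifier does in a given state: a computation step, a communication with the provers,
or nothing (it has halted). -/
inductive StateKind where
  | compute
  | communicate
  | halt

/-- A `k`-input, `r`-prover verifier: a randomized interactive Turing machine with `k + r + 2` tapes. -/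
structure Verifier (k r : ℕ) where
  /-- the states -/
  State : Type
  stateFinite : Finite State
  /-- the tape symbols other than the blank and the bits -/
  Extra : Type
  extraFinite : Finite Extra
  start : State
  kind : State → StateKind
  /-- the computation steps: given a fair coin flip, the state and the symbols under the heads, the new
  state, and for each tape the symbol to write and the movement of the head -/
  transition : Bool → State → (TapeIndex k r → Option (Bool ⊕ Extra)) →
    State × (TapeIndex k r → Option (Bool ⊕ Extra) × HeadMove)
  /-- the state in which the computation goes on after a communication phase -/
  resume : State → State

namespace Verifier

variable {k r : ℕ} (V : Verifier k r)

/-- Configurations: state, tapes, and the number of communication phases so far. -/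
structure Cfg where
  state : V.State
  tapes : TapeIndex k r → VTape V.Extra
  phases : ℕ

/-- The initial configuration on the inputs `x`. -/
def init (x : Fin k → List Bool) : V.Cfg where
  state := V.start
  tapes
    | .input j => VTape.ofString (x j)
    | _ => VTape.ofString []
  phases := 0

variable {V}

namespace Cfg

/-- A computation step with coin flip `b`. -/
def computeStep (c : V.Cfg) (b : Bool) : V.Cfg :=
  let o := V.transition b c.state fun j => (c.tapes j).read
  { state := o.1
    tapes := fun j => ((c.tapes j).write (o.2 j).1).move (o.2 j).2
    phases := c.phases }

/-- The message to prover `i`: the string on the `i`-th communication tape. -/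
def message (c : V.Cfg) (i : Fin r) : List Bool :=
  (c.tapes (.comm i)).content

/-- A communication phase in which prover `i` writes `a i` on the `i`-th communication tape. -/
def respond (c : V.Cfg) (a : Fin r → List Bool) : V.Cfg where
  state := V.resume c.state
  tapes
    | .comm i => VTape.ofString (a i)
    | j => c.tapes j
  phases := c.phases + 1

/-- One time step, given a coin flip for a computation step and the provers' answers for a
communication phase. -/
def step (c : V.Cfg) (b : Bool) (a : Fin r → List Bool) : V.Cfg :=
  match V.kind c.state with
  | .compute => c.computeStep b
  | .communicate => c.respond a
  | .halt => c

/-- The configuration is halting. -/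
def Halted (c : V.Cfg) : Prop :=
  V.kind c.state = .halt

/-- The configuration is halting and the output is accept: the first cell of the output tape
holds a `1`. -/
def Accepting (c : V.Cfg) : Prop :=
  c.Halted ∧ (c.tapes .output).content.head? = some true

end Cfg

variable (V)

/-- The configuration after `n` time steps, if the `j`-th time step uses the coin flip `coins j` and the
provers' answers in the `t`-th communication phase (counted from `0`) are `answers t`. -/
def run (x : Fin k → List Bool) (coins : ℕ → Bool) (answers : ℕ → Fin r → List Bool) : ℕ → V.Cfg
  | 0 => V.init x
  | n + 1 =>
    let c := run x coins answers n
    c.step (coins n) (answers c.phases)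

/-- The time complexity of the verifier on the inputs `x`: the maximal number of time steps before it
halts, over all coin flips and all responses of the provers (`⊤` if there is no bound). -/
noncomputable def time (x : Fin k → List Bool) : ℕ∞ :=
  ⨆ (coins : ℕ → Bool) (answers : ℕ → Fin r → List Bool),
    ⨅ (n : ℕ) (_ : (V.run x coins answers n).Halted), (n : ℕ∞)

/-- The maximal number of communication phases on the inputs `x`, over all coin flips and all
responses of the provers (`⊤` if there is no bound). -/
noncomputable def commPhases (x : Fin k → List Bool) : ℕ∞ :=
  ⨆ (coins : ℕ → Bool) (answers : ℕ → Fin r → List Bool) (n : ℕ),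
    ((V.run x coins answers n).phases : ℕ∞)

end Verifier

/-! ### Strategies and the quantum value -/

/-- A POVM on `ℂ^d` with outcomes in `{0,1}*`. -/
structure POVM (d : ℕ) where
  effect : List Bool → Matrix (Fin d) (Fin d) ℂ
  posSemidef : ∀ a, (effect a).PosSemidef
  hasSum_one : HasSum effect 1

/-- A finite-dimensional strategy for `r` provers. The space `(ℂ^d)^{⊗ r}` is represented in the
product basis, that is, as `ℂ^(Fin r → Fin d)`. -/
structure Strategy (r : ℕ) where
  /-- the local dimension -/
  d : ℕ
  /-- the shared state -/
  ψ : EuclideanSpace ℂ (Fin r → Fin d)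
  norm_ψ : ‖ψ‖ = 1
  /-- the measurement of prover `i` in round `t = 1, 2, …` with history `π`; the history lists, in
  order, all messages that prover `i` has received and sent before, and then the message that it
  receives in round `t` -/
  meas : Fin r → ℕ → List (List Bool) → POVM d

/-- The matrix of `B 0 ⊗ ⋯ ⊗ B (r - 1)` in the product basis of `(ℂ^d)^{⊗ r}`. -/
def tensorMatrix {r d : ℕ} (B : Fin r → Matrix (Fin d) (Fin d) ℂ) :
    Matrix (Fin r → Fin d) (Fin r → Fin d) ℂ :=
  Matrix.of fun s t => ∏ i, B i (s i) (t i)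

namespace Verifier

variable {k r : ℕ} (V : Verifier k r)

open Classical in
/-- The probability that the verifier halts within `n` further time steps and accepts, from the
configuration `c`, if `hist i` is the history of prover `i` and the provers share the state `φ`.
The state is not normalized: `‖φ‖²` is the probability of the past measurement outcomes, and the
outcome `a i` of the measurement `{M_i^a}` of prover `i` takes `φ` to `(⨂ᵢ √(M_i^(a i))) φ`. -/
noncomputable def acceptWithin (S : Strategy r) :
    ℕ → V.Cfg → (Fin r → List (List Bool)) → EuclideanSpace ℂ (Fin r → Fin S.d) → ℝ≥0∞
  | 0, c, _, φ => if c.Accepting then ‖φ‖ₑ ^ 2 else 0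
  | n + 1, c, hist, φ =>
    match V.kind c.state with
    | .halt => if c.Accepting then ‖φ‖ₑ ^ 2 else 0
    | .compute => ∑ b : Bool, 2⁻¹ * acceptWithin S n (c.computeStep b) hist φ
    | .communicate =>
      ∑' a : Fin r → List Bool,
        acceptWithin S n (c.respond a)
          (fun i => hist i ++ [c.message i, a i])
          (Matrix.toEuclideanLin
            (tensorMatrix fun i =>
              CFC.sqrt ((S.meas i (c.phases + 1) (hist i ++ [c.message i])).effect (a i))) φ)

/-- The value of the strategy `S`: the probability that the verifier on the inputs `x` halts and
accepts. -/
noncomputable def strategyValue (x : Fin k → List Bool) (S : Strategy r) : ℝ≥0∞ :=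
  ⨆ n : ℕ, V.acceptWithin S n (V.init x) (fun _ => []) S.ψ

/-- The quantum value of the verifier on the inputs `x`: the supremum of the values of all
finite-dimensional strategies. -/
noncomputable def quantumValue (x : Fin k → List Bool) : ℝ≥0∞ :=
  ⨆ S : Strategy r, V.strategyValue x S

end Verifier

/-! ### Complexity classes -/

/-- The class `MIP*[m, r, c, s]`: the languages with a polynomial-time `1`-input, `r`-prover verifier with
at most `m` communication phases, completeness `c` and soundness `s`. -/
def MIPStar (m r : ℕ) (c s : ℝ≥0∞) : Set (Language Bool) :=
  {L | ∃ (V : Verifier 1 r) (p : Polynomial ℕ), ∀ x : List Bool,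
    V.commPhases (fun _ => x) ≤ m ∧
    V.time (fun _ => x) ≤ (p.eval x.length : ℕ) ∧
    (x ∈ L → c ≤ V.quantumValue fun _ => x) ∧
    (x ∉ L → V.quantumValue (fun _ => x) < s)}

/-- Zero gap `MIP*`: the union of the classes `MIP*[m, r, 1, 1]` over all positive `m` and `r`. -/
def MIPStarZero : Set (Language Bool) :=
  {L | ∃ m r : ℕ, 1 ≤ m ∧ 1 ≤ r ∧ L ∈ MIPStar m r 1 1}

/-- The class `Π₂⁰` of the arithmetical hierarchy: the languages `{x | ∀ y, ∃ z, R (x, y, z) = 1}` with `R`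
total and computable. -/
def PiTwo : Set (Language Bool) :=
  {L | ∃ R : List Bool × ℕ × ℕ → Bool, Computable R ∧
    L = {x | ∀ y : ℕ, ∃ z : ℕ, R (x, y, z) = true}}

/-!
The quantum value of a verifier is a supremum over finite-dimensional strategies, and each lower bound
`y / (y + 1) < ω` can be certified by finite data. Hence `1 ≤ ω` is the statement that for every `y`
there is a certificate `z`, which is a `Π₂` condition as soon as the validity of certificates is
decidable. No bound on the running time or on the number of rounds is needed for this, because the
number of simulated steps is part of the certificate.

A certificate (`Certificate`) describes the shared state and matrices `L` by finitely many Gaussian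
integers with a common denominator. The measurement operators are `Lᴴ * L`, so that they are positive
semidefinite and therefore equal to the square roots of their effects. It remains to guarantee that the
effects `(Lᴴ * L) ^ 2` sum up to at most `1`. This is done by a test on the entries
(`Certificate.admissible`): the sum, including one extra outcome that stands for all remaining answers,
has to be close to `q / (q + 1)` times the identity, with a tolerance that keeps it below the identity
(`Certificate.effectSumMatrix_le`). Where the test fails, the operators are replaced by `0`.

Soundness (`Verifier.lt_quantumValue_of_certifies`): operators whose effects sum up to at most `1` are
completed to a POVM by an outcome that is not a permitted answer, which can only increase the
probability of acceptance.

Completeness (`Verifier.exists_certifies`): by monotone convergence, finitely many answers suffice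
(`Verifier.acceptWithin_le_iSup`). The probability of acceptance that they contribute is a continuous
function of the measurement operators and the state (`Verifier.tendsto_restrictedValue`), so the
operators may be scaled down slightly, which makes the test an open condition, and then be rounded.

Decidability (`Verifier.primrec_certifies`): the value of a certificate is computed in integer
arithmetic, by simulating all branches of the computation in parallel on a list of branches
(`Verifier.numerator`), and every function that is used in this is primitive recursive.
-/

/-! ### Primitive recursive combinators -/

-- Closure properties tagged `fun_prop` are stated for functions of a common argument, so that the tactic
-- can compose them.
attribute [fun_prop] Primrec
attribute [fun_prop] Primrec.id Primrec.const Primrec.comp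

namespace Primrec

variable {α β γ δ : Type*} [Primcodable α] [Primcodable β] [Primcodable γ] [Primcodable δ]

@[fun_prop]
theorem prodMk' {f : α → β} {g : α → γ} (hf : Primrec f) (hg : Primrec g) :
    Primrec fun a => (f a, g a) :=
  hf.pair hg

@[fun_prop]
theorem fst' {f : α → β × γ} (hf : Primrec f) : Primrec fun a => (f a).1 :=
  Primrec.fst.comp hf

@[fun_prop]
theorem snd' {f : α → β × γ} (hf : Primrec f) : Primrec fun a => (f a).2 :=
  Primrec.snd.comp hf

@[fun_prop]
theorem natAdd' {f g : α → ℕ} (hf : Primrec f) (hg : Primrec g) : Primrec fun a => f a + g a :=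
  Primrec.nat_add.comp hf hg

@[fun_prop]
theorem natSub' {f g : α → ℕ} (hf : Primrec f) (hg : Primrec g) : Primrec fun a => f a - g a :=
  Primrec.nat_sub.comp hf hg

@[fun_prop]
theorem natMul' {f g : α → ℕ} (hf : Primrec f) (hg : Primrec g) : Primrec fun a => f a * g a :=
  Primrec.nat_mul.comp hf hg

@[fun_prop]
theorem natDiv' {f g : α → ℕ} (hf : Primrec f) (hg : Primrec g) : Primrec fun a => f a / g a :=
  Primrec.nat_div.comp hf hg

@[fun_prop]
theorem natMod' {f g : α → ℕ} (hf : Primrec f) (hg : Primrec g) : Primrec fun a => f a % g a :=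
  Primrec.nat_mod.comp hf hg

@[fun_prop]
theorem natPow' {f g : α → ℕ} (hf : Primrec f) (hg : Primrec g) : Primrec fun a => f a ^ g a :=
  (Primrec₂.unpaired'.1 Nat.Primrec.pow).comp hf hg

@[fun_prop]
theorem decideLE' {f g : α → ℕ} (hf : Primrec f) (hg : Primrec g) :
    Primrec fun a => decide (f a ≤ g a) :=
  Primrec.nat_le.decide.comp hf hg

@[fun_prop]
theorem decideLT' {f g : α → ℕ} (hf : Primrec f) (hg : Primrec g) :
    Primrec fun a => decide (f a < g a) :=
  Primrec.nat_lt.decide.comp hf hg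

@[fun_prop]
theorem decideEq' [DecidableEq β] {f g : α → β} (hf : Primrec f) (hg : Primrec g) :
    Primrec fun a => decide (f a = g a) :=
  Primrec.eq.decide.comp hf hg

@[fun_prop]
theorem cond' {c : α → Bool} {f g : α → β} (hc : Primrec c) (hf : Primrec f) (hg : Primrec g) :
    Primrec fun a => bif c a then f a else g a :=
  hc.cond hf hg

@[fun_prop]
theorem encode' {f : α → β} (hf : Primrec f) : Primrec fun a => Encodable.encode (f a) :=
  Primrec.encode.comp hf

@[fun_prop]
theorem some' {f : α → β} (hf : Primrec f) : Primrec fun a => some (f a) :=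
  Primrec.option_some.comp hf

@[fun_prop]
theorem listMap' {f : α → List β} {g : α → β → γ} (hf : Primrec f)
    (hg : Primrec fun p : α × β => g p.1 p.2) : Primrec fun a => (f a).map (g a) :=
  Primrec.list_map hf hg

@[fun_prop]
theorem listFlatMap' {f : α → List β} {g : α → β → List γ} (hf : Primrec f)
    (hg : Primrec fun p : α × β => g p.1 p.2) : Primrec fun a => (f a).flatMap (g a) :=
  Primrec.list_flatMap hf hg

@[fun_prop]
theorem listFilterMap' {f : α → List β} {g : α → β → Option γ} (hf : Primrec f)
    (hg : Primrec fun p : α × β => g p.1 p.2) : Primrec fun a => (f a).filterMap (g a) :=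
  Primrec.listFilterMap hf hg

@[fun_prop]
theorem listRange' {f : α → ℕ} (hf : Primrec f) : Primrec fun a => List.range (f a) :=
  Primrec.list_range.comp hf

@[fun_prop]
theorem listGetD' {f : α → List β} {g : α → ℕ} (d : β) (hf : Primrec f) (hg : Primrec g) :
    Primrec fun a => (f a).getD (g a) d :=
  (Primrec.list_getD d).comp hf hg

@[fun_prop]
theorem listLength' {f : α → List β} (hf : Primrec f) : Primrec fun a => (f a).length :=
  Primrec.list_length.comp hf

@[fun_prop]
theorem listAppend' {f g : α → List β} (hf : Primrec f) (hg : Primrec g) :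
    Primrec fun a => f a ++ g a :=
  Primrec.list_append.comp hf hg

@[fun_prop]
theorem listCons' {f : α → β} {g : α → List β} (hf : Primrec f) (hg : Primrec g) :
    Primrec fun a => f a :: g a :=
  Primrec.list_cons.comp hf hg

@[fun_prop]
theorem listHead?' {f : α → List β} (hf : Primrec f) : Primrec fun a => (f a).head? :=
  Primrec.list_head?.comp hf

@[fun_prop]
theorem listSet' {f : α → List β} {g : α → ℕ} {h : α → β} (hf : Primrec f) (hg : Primrec g)
    (hh : Primrec h) : Primrec fun a => (f a).set (g a) (h a) :=
  Primrec.list_set.comp hf (hg.pair hh)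

@[fun_prop]
theorem listReplicate' {f : α → ℕ} (x : β) (hf : Primrec f) :
    Primrec fun a => List.replicate (f a) x :=
  (show Primrec fun a => (List.range (f a)).map fun _ => x by fun_prop).of_eq fun a => by simp

@[fun_prop]
theorem listAll' {f : α → List β} {p : α → β → Bool} (hf : Primrec f)
    (hp : Primrec fun x : α × β => p x.1 x.2) : Primrec fun a => (f a).all (p a) := by
  refine (Primrec.list_foldr (h := fun a (x : β × Bool) => p a x.1 && x.2) hf
    (Primrec.const true) ?_).of_eq fun a => ?_
  · exact Primrec.and.comp (hp.comp (Primrec.fst.pair (Primrec.fst.comp Primrec.snd)))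
      (Primrec.snd.comp Primrec.snd)
  · induction f a with
    | nil => rfl
    | cons b l ih => rw [List.foldr_cons, ih, List.all_cons]

@[fun_prop]
theorem iterate' {f : α → ℕ} {g : α → β} {h : α → β → β} (hf : Primrec f) (hg : Primrec g)
    (hh : Primrec fun p : α × β => h p.1 p.2) : Primrec fun a => (h a)^[f a] (g a) :=
  Primrec.nat_iterate hf hg hh

theorem listSum [AddMonoid β] (hadd : Primrec fun p : β × β => p.1 + p.2) :
    Primrec fun l : List β => l.sum :=
  Primrec.list_foldr (h := fun _ x => x.1 + x.2) Primrec.id (Primrec.const 0)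
    (hadd.comp Primrec.snd)

theorem sumRange [AddCommMonoid β] (hadd : Primrec fun p : β × β => p.1 + p.2)
    {f : α → ℕ} {g : α → ℕ → β} (hf : Primrec f) (hg : Primrec fun p : α × ℕ => g p.1 p.2) :
    Primrec fun a => ∑ i ∈ Finset.range (f a), g a i :=
  ((listSum hadd).comp (listMap' (listRange' hf) hg)).of_eq fun _ => rfl

@[fun_prop]
theorem listSumNat' {f : α → List ℕ} (hf : Primrec f) : Primrec fun a => (f a).sum :=
  (listSum (by fun_prop)).comp hf

@[fun_prop]
theorem sumRangeNat' {f : α → ℕ} {g : α → ℕ → ℕ} (hf : Primrec f)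
    (hg : Primrec fun p : α × ℕ => g p.1 p.2) :
    Primrec fun a => ∑ i ∈ Finset.range (f a), g a i :=
  sumRange (by fun_prop) hf hg

theorem finApp {n : ℕ} {f : α → Fin n → β} (i : Fin n) (hf : Primrec f) : Primrec fun a => f a i :=
  (Primrec.fin_curry.1 hf).comp Primrec.id (Primrec.const i)

theorem finPi {n : ℕ} {f : α → Fin n → β} (hf : ∀ i, Primrec fun a => f a i) : Primrec f :=
  Primrec.fin_curry.2 (Primrec.fin_curry₁ (f := fun i a => f a i).2 hf).swap

end Primrec

/-- A finite type with the coding that comes from an arbitrary enumeration of its elements. All functions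
on it are primitive recursive, whatever the enumeration. -/
noncomputable abbrev primcodableOfFinite (α : Type*) [Finite α] : Primcodable α :=
  Primcodable.ofEquiv (Fin (Nat.card α)) (Finite.equivFin α)

/-- A function that is defined by a case distinction over a finite type is primitive recursive if
each of the cases is. -/
theorem Primrec.finite_cases {α β σ : Type*} [Primcodable α] [Primcodable β] [Primcodable σ]
    [Finite β] {f : β → α → σ} {g : α → β} (hg : Primrec g) (hf : ∀ b, Primrec (f b)) :
    Primrec fun a => f (g a) a := by
  let e := Finite.equivFin β
  have h1 : Primrec₂ fun (i : Fin (Nat.card β)) a => f (e.symm i) a :=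
    Primrec.fin_curry₁.2 fun i => hf _
  exact (h1.comp ((Primrec.dom_finite e).comp hg) Primrec.id).of_eq fun a => by simp

/-! ### Integers and Gaussian integers -/

namespace Primrec

variable {α β : Type*} [Primcodable α] [Primcodable β]

/-- The code of an integer is twice its value, or twice its absolute value minus one if it is
negative. -/
theorem encode_int (z : ℤ) :
    Encodable.encode z = if 0 ≤ z then 2 * z.toNat else 2 * (-z).toNat - 1 := by
  rcases z with n | n
  · have : Encodable.encode (Int.ofNat n) = 2 * n := rfl
    rw [this]; simp
  · have : Encodable.encode (Int.negSucc n) = 2 * n + 1 := rfl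
    rw [this]
    have h : ¬ (0 ≤ Int.negSucc n) := by simp
    rw [if_neg h, Int.neg_negSucc]
    simp; omega

@[fun_prop]
theorem toNat' {f : α → ℤ} (hf : Primrec f) : Primrec fun a => (f a).toNat := by
  have h : Primrec fun z : ℤ =>
      bif decide (Encodable.encode z % 2 = 0) then Encodable.encode z / 2 else 0 := by
    fun_prop
  refine (h.comp hf).of_eq fun a => ?_
  rw [encode_int]
  split_ifs with h0
  · simp
  · have : ¬ ((2 * (-(f a)).toNat - 1) % 2 = 0) := by omega
    simp [this]; omega

@[fun_prop]
theorem intSubNat' {f g : α → ℕ} (hf : Primrec f) (hg : Primrec g) :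
    Primrec fun a => (f a : ℤ) - (g a : ℤ) := by
  refine Primrec.encode_iff.1 ?_
  have h : Primrec fun a =>
      bif decide (g a ≤ f a) then 2 * (f a - g a) else 2 * (g a - f a) - 1 := by
    fun_prop
  refine h.of_eq fun a => ?_
  rw [encode_int]
  by_cases h : g a ≤ f a
  · have h' : (0 : ℤ) ≤ (f a : ℤ) - g a := by omega
    simp only [h, h', decide_true, cond_true, if_true]; omega
  · have h' : ¬ (0 : ℤ) ≤ (f a : ℤ) - g a := by omega
    simp only [h, h', decide_false, cond_false, if_false]; omega

@[fun_prop]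
theorem intNeg' {f : α → ℤ} (hf : Primrec f) : Primrec fun a => -f a := by
  have h0 : Primrec fun z : ℤ => z.toNat := by fun_prop
  have h1 : Primrec fun z : ℤ =>
      bif decide (Encodable.encode z % 2 = 0) then 0 else Encodable.encode z / 2 + 1 := by
    fun_prop
  have h2 : Primrec fun z : ℤ => (((bif decide (Encodable.encode z % 2 = 0) then 0
      else Encodable.encode z / 2 + 1 : ℕ) : ℤ) - (z.toNat : ℤ)) := intSubNat' h1 h0
  refine (h2.comp hf).of_eq fun a => ?_
  rw [encode_int]
  split_ifs with h0
  · simp [h0]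
  · have : ¬ ((2 * (-(f a)).toNat - 1) % 2 = 0) := by omega
    simp [this]; omega

@[fun_prop]
theorem intAdd' {f g : α → ℤ} (hf : Primrec f) (hg : Primrec g) : Primrec fun a => f a + g a := by
  have h : Primrec fun a => (((f a).toNat + (g a).toNat : ℕ) : ℤ) -
      (((-f a).toNat + (-g a).toNat : ℕ) : ℤ) := by fun_prop
  exact h.of_eq fun a => by omega

@[fun_prop]
theorem intMul' {f g : α → ℤ} (hf : Primrec f) (hg : Primrec g) : Primrec fun a => f a * g a := by
  have h : Primrec fun a =>
      (((f a).toNat * (g a).toNat + (-f a).toNat * (-g a).toNat : ℕ) : ℤ) -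
      (((f a).toNat * (-g a).toNat + (-f a).toNat * (g a).toNat : ℕ) : ℤ) := by fun_prop
  refine h.of_eq fun a => ?_
  have hx : ∀ x : ℤ, x = (x.toNat : ℤ) - ((-x).toNat : ℤ) := fun x => by omega
  conv_rhs => rw [hx (f a), hx (g a)]
  push_cast; ring

end Primrec

/-- Gaussian integers are coded as pairs of integers. -/
instance : Primcodable GaussianInt :=
  Primcodable.ofEquiv (ℤ × ℤ) ⟨fun z => (z.re, z.im), fun p => ⟨p.1, p.2⟩, fun _ => rfl, fun _ => rfl⟩

namespace Primrec

variable {α β : Type*} [Primcodable α] [Primcodable β]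

@[fun_prop]
theorem gaussianRe' {f : α → GaussianInt} (hf : Primrec f) : Primrec fun a => (f a).re :=
  (Primrec.fst.comp Primrec.of_equiv).comp hf

@[fun_prop]
theorem gaussianIm' {f : α → GaussianInt} (hf : Primrec f) : Primrec fun a => (f a).im :=
  (Primrec.snd.comp Primrec.of_equiv).comp hf

theorem gaussianMk' {f g : α → ℤ} (hf : Primrec f) (hg : Primrec g) :
    Primrec fun a => (⟨f a, g a⟩ : GaussianInt) :=
  Primrec.of_equiv_symm.comp (hf.pair hg)

theorem gaussian_of_re_im {f : α → GaussianInt} (hre : Primrec fun a => (f a).re)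
    (him : Primrec fun a => (f a).im) : Primrec f :=
  gaussianMk' hre him

@[fun_prop]
theorem gaussianAdd' {f g : α → GaussianInt} (hf : Primrec f) (hg : Primrec g) :
    Primrec fun a => f a + g a :=
  gaussian_of_re_im (by simp only [Zsqrtd.re_add]; fun_prop) (by simp only [Zsqrtd.im_add]; fun_prop)

@[fun_prop]
theorem gaussianNeg' {f : α → GaussianInt} (hf : Primrec f) : Primrec fun a => -f a :=
  gaussian_of_re_im (by simp only [Zsqrtd.re_neg]; fun_prop) (by simp only [Zsqrtd.im_neg]; fun_prop)

@[fun_prop]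
theorem gaussianSub' {f g : α → GaussianInt} (hf : Primrec f) (hg : Primrec g) :
    Primrec fun a => f a - g a := by
  simp only [sub_eq_add_neg]; fun_prop

@[fun_prop]
theorem gaussianMul' {f g : α → GaussianInt} (hf : Primrec f) (hg : Primrec g) :
    Primrec fun a => f a * g a :=
  gaussian_of_re_im (by simp only [Zsqrtd.re_mul]; fun_prop) (by simp only [Zsqrtd.im_mul]; fun_prop)

@[fun_prop]
theorem gaussianStar' {f : α → GaussianInt} (hf : Primrec f) : Primrec fun a => star (f a) :=
  gaussian_of_re_im (by simp only [Zsqrtd.re_star]; fun_prop)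
    (by simp only [Zsqrtd.im_star]; fun_prop)

@[fun_prop]
theorem gaussianNatCast' {f : α → ℕ} (hf : Primrec f) : Primrec fun a => (f a : GaussianInt) :=
  gaussian_of_re_im
    ((intSubNat' hf (Primrec.const 0)).of_eq fun a => by simp)
    ((Primrec.const 0).of_eq fun a => by simp)

@[fun_prop]
theorem gaussianNorm' {f : α → GaussianInt} (hf : Primrec f) : Primrec fun a => (f a).norm.toNat := by
  have h : Primrec fun a => ((f a).re * (f a).re + (f a).im * (f a).im).toNat := by fun_prop
  exact h.of_eq fun a => by simp [Zsqrtd.norm]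

@[fun_prop]
theorem gaussianSumRange' {f : α → ℕ} {g : α → ℕ → GaussianInt} (hf : Primrec f)
    (hg : Primrec fun p : α × ℕ => g p.1 p.2) :
    Primrec fun a => ∑ i ∈ Finset.range (f a), g a i :=
  sumRange (by fun_prop) hf hg

@[fun_prop]
theorem gaussianListSum' {f : α → List GaussianInt} (hf : Primrec f) :
    Primrec fun a => (f a).sum :=
  (listSum (by fun_prop)).comp hf

theorem gaussianFinProd {n : ℕ} {f : α → Fin n → GaussianInt}
    (hf : ∀ i, Primrec fun a => f a i) : Primrec fun a => ∏ i, f a i := by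
  induction n with
  | zero => simpa using Primrec.const 1
  | succ n ih =>
    simp only [Fin.prod_univ_succ]
    exact gaussianMul' (hf 0) (ih fun i => hf i.succ)

end Primrec

/-! ### The verifier's steps are primitive recursive -/

instance : Finite HeadMove :=
  Finite.of_surjective
    (fun i : Fin 3 => if i = 0 then HeadMove.left else if i = 1 then HeadMove.right else HeadMove.stay)
    fun m => by
      cases m
      · exact ⟨0, by simp⟩
      · exact ⟨1, by simp⟩
      · exact ⟨2, by simp⟩

instance : Finite StateKind :=
  Finite.of_surjective
    (fun i : Fin 3 => if i = 0 then StateKind.compute else if i = 1 then StateKind.communicate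
      else StateKind.halt)
    fun m => by
      cases m
      · exact ⟨0, by simp⟩
      · exact ⟨1, by simp⟩
      · exact ⟨2, by simp⟩

instance (k r : ℕ) : Finite (TapeIndex k r) :=
  Finite.of_surjective
    (fun i : (Fin k ⊕ Fin r) ⊕ Bool => match i with
      | .inl (.inl j) => TapeIndex.input j
      | .inl (.inr j) => TapeIndex.comm j
      | .inr true => TapeIndex.work
      | .inr false => TapeIndex.output)
    fun m => by
      cases m with
      | input j => exact ⟨.inl (.inl j), rfl⟩
      | comm j => exact ⟨.inl (.inr j), rfl⟩
      | work => exact ⟨.inr true, rfl⟩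
      | output => exact ⟨.inr false, rfl⟩

noncomputable instance : Primcodable HeadMove := primcodableOfFinite _

noncomputable instance : Primcodable StateKind := primcodableOfFinite _

/-- Families indexed by the tapes are coded as tuples, along an enumeration of the tapes. -/
noncomputable instance {k r : ℕ} {α : Type*} [Primcodable α] : Primcodable (TapeIndex k r → α) :=
  Primcodable.ofEquiv (Fin (Nat.card (TapeIndex k r)) → α)
    (Equiv.arrowCongr (Finite.equivFin _) (Equiv.refl α))

namespace Primrec

variable {α β : Type*} [Primcodable α] [Primcodable β] {k r : ℕ}

theorem tapeApp {f : α → TapeIndex k r → β} (hf : Primrec f) (j : TapeIndex k r) :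
    Primrec fun a => f a j := by
  have h : Primrec fun a => (Equiv.arrowCongr (Finite.equivFin (TapeIndex k r)) (Equiv.refl β)) (f a) :=
    Primrec.of_equiv.comp hf
  exact (finApp (Finite.equivFin _ j) h).of_eq fun a => by simp [Equiv.arrowCongr]

theorem tapePi {f : α → TapeIndex k r → β} (hf : ∀ j, Primrec fun a => f a j) : Primrec f := by
  have h : Primrec fun a (i : Fin (Nat.card (TapeIndex k r))) => f a ((Finite.equivFin _).symm i) :=
    finPi fun i => hf _
  refine ((Primrec.of_equiv_symm (e := Equiv.arrowCongr (Finite.equivFin (TapeIndex k r))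
    (Equiv.refl β))).comp h).of_eq fun a => ?_
  funext j
  simp [Equiv.arrowCongr]

end Primrec

instance {A : Type} [Primcodable A] : Primcodable (VTape A) :=
  Primcodable.ofEquiv (List (Option (Bool ⊕ A)) × ℕ)
    ⟨fun t => (t.cells, t.head), fun p => ⟨p.1, p.2⟩, fun _ => rfl, fun _ => rfl⟩

namespace VTape

variable {A : Type} [Primcodable A] {α : Type*} [Primcodable α]

@[fun_prop]
theorem primrec_cells {f : α → VTape A} (hf : Primrec f) : Primrec fun a => (f a).cells :=
  (Primrec.fst.comp Primrec.of_equiv).comp hf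

@[fun_prop]
theorem primrec_head {f : α → VTape A} (hf : Primrec f) : Primrec fun a => (f a).head :=
  (Primrec.snd.comp Primrec.of_equiv).comp hf

@[fun_prop]
theorem primrec_mk {f : α → List (Option (Bool ⊕ A))} {g : α → ℕ} (hf : Primrec f)
    (hg : Primrec g) : Primrec fun a => VTape.mk (f a) (g a) :=
  Primrec.of_equiv_symm.comp (hf.pair hg)

@[fun_prop]
theorem primrec_ofString {f : α → List Bool} (hf : Primrec f) :
    Primrec fun a => (ofString (f a) : VTape A) := by
  unfold ofString
  have h : Primrec fun b : Bool => (some (Sum.inl b) : Option (Bool ⊕ A)) := Primrec.dom_bool _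
  exact primrec_mk (Primrec.listMap' hf (h.comp Primrec.snd)) (Primrec.const 0)

@[fun_prop]
theorem primrec_read {f : α → VTape A} (hf : Primrec f) : Primrec fun a => (f a).read := by
  unfold read
  fun_prop

@[fun_prop]
theorem primrec_write {f : α → VTape A} {g : α → Option (Bool ⊕ A)} (hf : Primrec f)
    (hg : Primrec g) : Primrec fun a => (f a).write (g a) := by
  unfold write
  fun_prop

@[fun_prop]
theorem primrec_move {f : α → VTape A} {g : α → HeadMove} (hf : Primrec f) (hg : Primrec g) :
    Primrec fun a => (f a).move (g a) :=
  Primrec.finite_cases (f := fun m a => (f a).move m) hg fun m => by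
    cases m <;> simp only [move] <;> fun_prop

@[fun_prop]
theorem primrec_content [Finite A] {f : α → VTape A} (hf : Primrec f) :
    Primrec fun a => (f a).content := by
  have h : Primrec fun p : Option (Bool ⊕ A) × List Bool => match p.1 with
      | some (Sum.inl b) => b :: p.2
      | _ => [] :=
    Primrec.finite_cases (f := fun (s : Option (Bool ⊕ A)) (p : Option (Bool ⊕ A) × List Bool) =>
        match s with
        | some (Sum.inl b) => b :: p.2
        | _ => []) Primrec.fst fun s => by
      rcases s with _ | b | e
      · exact Primrec.const _
      · exact Primrec.listCons' (Primrec.const b) Primrec.snd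
      · exact Primrec.const _
  refine (Primrec.list_foldr (h := fun _ (p : Option (Bool ⊕ A) × List Bool) => match p.1 with
      | some (Sum.inl b) => b :: p.2
      | _ => []) (primrec_cells hf) (Primrec.const []) (h.comp Primrec.snd)).of_eq fun a => ?_
  unfold content
  induction (f a).cells with
  | nil => rfl
  | cons s l ih =>
    rw [List.foldr_cons, ih]
    rcases s with _ | b | e <;> rfl

end VTape

namespace Verifier

variable {k r : ℕ} (V : Verifier k r)

instance : Finite V.State := V.stateFinite

instance : Finite V.Extra := V.extraFinite

noncomputable instance : Primcodable V.State := primcodableOfFinite _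

noncomputable instance : Primcodable V.Extra := primcodableOfFinite _

noncomputable instance : Primcodable V.Cfg :=
  Primcodable.ofEquiv (V.State × (TapeIndex k r → VTape V.Extra) × ℕ)
    ⟨fun c => (c.state, c.tapes, c.phases), fun p => ⟨p.1, p.2.1, p.2.2⟩, fun _ => rfl, fun _ => rfl⟩

variable {V} {α : Type*} [Primcodable α]

namespace Cfg

@[fun_prop]
theorem primrec_state {f : α → V.Cfg} (hf : Primrec f) : Primrec fun a => (f a).state :=
  (Primrec.fst.comp Primrec.of_equiv).comp hf

@[fun_prop]
theorem primrec_tapes {f : α → V.Cfg} (hf : Primrec f) : Primrec fun a => (f a).tapes :=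
  ((Primrec.fst.comp Primrec.snd).comp Primrec.of_equiv).comp hf

@[fun_prop]
theorem primrec_phases {f : α → V.Cfg} (hf : Primrec f) : Primrec fun a => (f a).phases :=
  ((Primrec.snd.comp Primrec.snd).comp Primrec.of_equiv).comp hf

@[fun_prop]
theorem primrec_mk {f : α → V.State} {g : α → TapeIndex k r → VTape V.Extra} {h : α → ℕ}
    (hf : Primrec f) (hg : Primrec g) (hh : Primrec h) :
    Primrec fun a => (Cfg.mk (f a) (g a) (h a) : V.Cfg) :=
  Primrec.of_equiv_symm.comp (hf.pair (hg.pair hh))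

@[fun_prop]
theorem primrec_kind {f : α → V.Cfg} (hf : Primrec f) : Primrec fun a => V.kind (f a).state :=
  (Primrec.dom_finite V.kind).comp (primrec_state hf)

@[fun_prop]
theorem primrec_message {f : α → V.Cfg} (hf : Primrec f) (i : Fin r) :
    Primrec fun a => (f a).message i :=
  VTape.primrec_content (Primrec.tapeApp (primrec_tapes hf) _)

@[fun_prop]
theorem primrec_respond {f : α → V.Cfg} {g : α → Fin r → List Bool} (hf : Primrec f)
    (hg : Primrec g) : Primrec fun a => (f a).respond (g a) := by
  unfold respond
  refine primrec_mk ((Primrec.dom_finite V.resume).comp (primrec_state hf))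
    (Primrec.tapePi fun j => ?_) (by fun_prop)
  cases j with
  | comm i => exact VTape.primrec_ofString (Primrec.finApp i hg)
  | input i => exact Primrec.tapeApp (primrec_tapes hf) _
  | work => exact Primrec.tapeApp (primrec_tapes hf) _
  | output => exact Primrec.tapeApp (primrec_tapes hf) _

@[fun_prop]
theorem primrec_computeStep {f : α → V.Cfg} (hf : Primrec f) (b : Bool) :
    Primrec fun a => (f a).computeStep b := by
  unfold computeStep
  have ho : Primrec fun a => V.transition b (f a).state fun j => ((f a).tapes j).read :=
    (Primrec.dom_finite fun p : V.State × (TapeIndex k r → Option (Bool ⊕ V.Extra)) =>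
      V.transition b p.1 p.2).comp
      ((primrec_state hf).pair
        (Primrec.tapePi fun j => VTape.primrec_read (Primrec.tapeApp (primrec_tapes hf) j)))
  refine primrec_mk (Primrec.fst.comp ho) (Primrec.tapePi fun j => ?_) (primrec_phases hf)
  have hj := Primrec.tapeApp (Primrec.snd.comp ho) j
  exact VTape.primrec_move (VTape.primrec_write (Primrec.tapeApp (primrec_tapes hf) j)
    (Primrec.fst.comp hj)) (Primrec.snd.comp hj)

/-- Acceptance depends only on the state and on the first cell of the output tape, hence on an element of
a finite type. -/
theorem accepting_iff (c : V.Cfg) : c.Accepting ↔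
    V.kind c.state = .halt ∧ (c.tapes .output).cells.head? = some (some (Sum.inl true)) := by
  unfold Accepting Halted VTape.content
  refine and_congr_right fun _ => ?_
  rcases (c.tapes .output).cells with _ | ⟨_ | b | e, l⟩ <;> simp [VTape.bitPrefix]

open Classical in
@[fun_prop]
theorem primrec_accepting {f : α → V.Cfg} (hf : Primrec f) :
    Primrec fun a => decide (f a).Accepting := by
  have h : Primrec fun p : V.State × Option (Option (Bool ⊕ V.Extra)) =>
      decide (V.kind p.1 = .halt ∧ p.2 = some (some (Sum.inl true))) := Primrec.dom_finite _
  refine (h.comp ((primrec_state hf).pair (Primrec.listHead?' (VTape.primrec_cells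
    (Primrec.tapeApp (primrec_tapes hf) TapeIndex.output))))).of_eq fun a => ?_
  simp only [accepting_iff]

end Cfg

@[fun_prop]
theorem primrec_init {f : α → Fin k → List Bool} (hf : Primrec f) :
    Primrec fun a => V.init (f a) := by
  unfold init
  refine Cfg.primrec_mk (Primrec.const _) (Primrec.tapePi fun j => ?_) (Primrec.const _)
  cases j with
  | input i => exact VTape.primrec_ofString (Primrec.finApp i hf)
  | comm i => exact Primrec.const _
  | work => exact Primrec.const _
  | output => exact Primrec.const _

end Verifier

/-! ### Certificates and their evaluation in integer arithmetic -/

/-- A finite description of a strategy, together with the parameters of its evaluation. All matrices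
and vectors have Gaussian integer entries, to be divided by powers of `scale + 1`. -/
structure Certificate where
  /-- the number of time steps that are simulated -/
  fuel : ℕ
  /-- the local dimension -/
  dim : ℕ
  /-- only answers with code below `bound` are used -/
  bound : ℕ
  /-- the common denominator, minus one -/
  scale : ℕ
  /-- the measurement operators are to sum up to about `slack / (slack + 1)` -/
  slack : ℕ
  /-- the coordinates of the (not normalized) shared state -/
  state : List GaussianInt
  /-- the table of all matrix entries, indexed by the codes of their positions; entries beyond its
  end are `0` -/
  table : List GaussianInt

/-- A certificate as the tuple of its components. -/
def Certificate.equivProd :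
    Certificate ≃ ℕ × ℕ × ℕ × ℕ × ℕ × List GaussianInt × List GaussianInt where
  toFun C := (C.fuel, C.dim, C.bound, C.scale, C.slack, C.state, C.table)
  invFun p := ⟨p.1, p.2.1, p.2.2.1, p.2.2.2.1, p.2.2.2.2.1, p.2.2.2.2.2.1, p.2.2.2.2.2.2⟩

instance : Primcodable Certificate :=
  Primcodable.ofEquiv _ Certificate.equivProd

/-- The strings with code below `B`, without repetitions. -/
def answerList (B : ℕ) : List (List Bool) :=
  (List.range B).filterMap (Encodable.decode₂ (List Bool))

theorem mem_answerList {B : ℕ} {w : List Bool} : w ∈ answerList B ↔ Encodable.encode w < B := by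
  simp [answerList, ← Option.mem_def, Encodable.mem_decode₂]

theorem answerList_nodup (B : ℕ) : (answerList B).Nodup := by
  refine List.Nodup.filterMap ?_ List.nodup_range
  intro n n' w hn hn'
  rw [Encodable.mem_decode₂] at hn hn'
  rw [← hn, ← hn']

/-- The `i`-th digit of `s` in base `b`. -/
def digit (b s i : ℕ) : ℕ :=
  s / b ^ i % b

namespace Certificate

variable (C : Certificate) {r : ℕ}

/-- The entry `L u v` of the table for prover `i`, round `t`, history `π` and outcome `a`, where the
outcome `none` collects everything that is not a permitted answer. -/
def entry (i : Fin r) (t : ℕ) (π : List (List Bool)) (a : Option (List Bool)) (u v : ℕ) :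
    GaussianInt :=
  C.table.getD (Encodable.encode (i, t, π, a, u, v)) 0

/-- The entries of `Lᴴ * L`. -/
def gram (i : Fin r) (t : ℕ) (π : List (List Bool)) (a : Option (List Bool)) (u v : ℕ) :
    GaussianInt :=
  ∑ w ∈ Finset.range C.dim, star (C.entry i t π a w u) * C.entry i t π a w v

/-- The entries of the sum of the matrices `(Lᴴ * L) ^ 2` over all outcomes. -/
def effectSum (i : Fin r) (t : ℕ) (π : List (List Bool)) (u v : ℕ) : GaussianInt :=
  ((none :: (answerList C.bound).map some).map fun a =>
    ∑ w ∈ Finset.range C.dim, C.gram i t π a u w * C.gram i t π a w v).sum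

/-- The test that the sum `Z` of the effects is entrywise close to a multiple of the identity matrix:
every entry of `(slack + 1) * Z - slack * D * 1` has absolute value at most `D / dim`, where
`D = (scale + 1) ^ 4` is the common denominator of the effects. -/
def admissible (i : Fin r) (t : ℕ) (π : List (List Bool)) : Bool :=
  (List.range C.dim).all fun u => (List.range C.dim).all fun v =>
    decide ((((C.slack + 1 : ℕ) : GaussianInt) * C.effectSum i t π u v -
      bif decide (u = v) then ((C.slack * (C.scale + 1) ^ 4 : ℕ) : GaussianInt) else 0).norm.toNat *
        C.dim ^ 2 ≤ ((C.scale + 1) ^ 4) ^ 2)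

/-- The entries of the measurement operator, before the division by `(scale + 1) ^ 2`; it is `0` if
the test fails. -/
def kraus (i : Fin r) (t : ℕ) (π : List (List Bool)) (a : List Bool) (u v : ℕ) : GaussianInt :=
  bif C.admissible i t π then C.gram i t π (some a) u v else 0

/-- The action of the tensor product of the measurement operators on a vector, whose coordinates are
listed by the numbers below `dim ^ r`. -/
def applyKraus (t : ℕ) (π : Fin r → List (List Bool)) (a : Fin r → List Bool)
    (φ : List GaussianInt) : List GaussianInt :=
  (List.range (C.dim ^ r)).map fun s => ∑ s' ∈ Finset.range (C.dim ^ r),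
    (∏ i, C.kraus i t (π i) (a i) (digit C.dim s i) (digit C.dim s' i)) * φ.getD s' 0

/-- The squared norm of a vector. -/
def normSum (r : ℕ) (φ : List GaussianInt) : ℕ :=
  ∑ s ∈ Finset.range (C.dim ^ r), (φ.getD s 0).norm.toNat

/-- The factor by which one time step multiplies the common denominator of all probabilities. -/
def denom (r : ℕ) : ℕ :=
  2 * (C.scale + 1) ^ (4 * r)

/-- The `q`-th tuple of permitted answers. -/
def answerTuple (r q : ℕ) : Fin r → List Bool := fun i =>
  (answerList C.bound).getD (digit (answerList C.bound).length q i) []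

end Certificate

namespace Verifier

variable {k r : ℕ} (V : Verifier k r)

/-- A branch of the computation: an integer weight, the configuration, the histories and the
(not normalized) state of the provers. -/
abbrev Branch : Type :=
  ℕ × V.Cfg × (Fin r → List (List Bool)) × List GaussianInt

variable {V}

/-- The branches after one more time step, for a state of the given kind. The weights are
scaled so that in every time step the common denominator is multiplied by `Certificate.denom`. -/
def Branch.nextOfKind (C : Certificate) (e : V.Branch) : StateKind → List V.Branch
  | .halt => [(C.denom r * e.1, e.2)]
  | .compute =>
    [((C.scale + 1) ^ (4 * r) * e.1, e.2.1.computeStep true, e.2.2),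
      ((C.scale + 1) ^ (4 * r) * e.1, e.2.1.computeStep false, e.2.2)]
  | .communicate =>
    (List.range ((answerList C.bound).length ^ r)).map fun q =>
      (2 * e.1, e.2.1.respond (C.answerTuple r q),
        fun i => e.2.2.1 i ++ [e.2.1.message i, C.answerTuple r q i],
        C.applyKraus (e.2.1.phases + 1) (fun i => e.2.2.1 i ++ [e.2.1.message i])
          (C.answerTuple r q) e.2.2.2)

/-- The branches after one more time step. -/
def Branch.next (C : Certificate) (e : V.Branch) : List V.Branch :=
  Branch.nextOfKind C e (V.kind e.2.1.state)

open Classical in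
/-- The contribution of a branch to the probability of acceptance. -/
noncomputable def Branch.contribution (C : Certificate) (e : V.Branch) : ℕ :=
  bif decide e.2.1.Accepting then e.1 * C.normSum r e.2.2.2 else 0

variable (V)

/-- The numerator of the probability of acceptance of the strategy that is described by `C`. -/
noncomputable def numerator (C : Certificate) (x : Fin k → List Bool) : ℕ :=
  (((List.flatMap (Branch.next C))^[C.fuel]
    [((1, V.init x, fun _ => [], C.state) : V.Branch)]).map (Branch.contribution C)).sum

/-- The test that `C` certifies a probability of acceptance above `1 - 1 / (y + 1)`. -/
noncomputable def certifies (C : Certificate) (x : Fin k → List Bool) (y : ℕ) : Bool :=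
  decide (y * (C.denom r ^ C.fuel * C.normSum r C.state) < (y + 1) * V.numerator C x)

end Verifier

/-! ### The evaluation is primitive recursive -/

@[fun_prop]
theorem Primrec.digit' {α : Type*} [Primcodable α] {f g h : α → ℕ} (hf : Primrec f)
    (hg : Primrec g) (hh : Primrec h) : Primrec fun a => digit (f a) (g a) (h a) := by
  unfold digit
  fun_prop

@[fun_prop]
theorem primrec_answerList {α : Type*} [Primcodable α] {f : α → ℕ} (hf : Primrec f) :
    Primrec fun a => answerList (f a) :=
  Primrec.listFilterMap' (Primrec.listRange' hf) (Primrec.decode₂.comp Primrec.snd)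

namespace Certificate

variable {α : Type*} [Primcodable α] {r : ℕ} {C : α → Certificate}

theorem primrec_equivProd : Primrec equivProd :=
  Primrec.of_equiv

@[fun_prop]
theorem primrec_fuel (hC : Primrec C) : Primrec fun a => (C a).fuel :=
  Primrec.fst.comp (primrec_equivProd.comp hC)

@[fun_prop]
theorem primrec_dim (hC : Primrec C) : Primrec fun a => (C a).dim :=
  Primrec.fst.comp (Primrec.snd.comp (primrec_equivProd.comp hC))

@[fun_prop]
theorem primrec_bound (hC : Primrec C) : Primrec fun a => (C a).bound :=
  Primrec.fst.comp (Primrec.snd.comp (Primrec.snd.comp (primrec_equivProd.comp hC)))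

@[fun_prop]
theorem primrec_scale (hC : Primrec C) : Primrec fun a => (C a).scale :=
  Primrec.fst.comp (Primrec.snd.comp (Primrec.snd.comp (Primrec.snd.comp (primrec_equivProd.comp hC))))

@[fun_prop]
theorem primrec_slack (hC : Primrec C) : Primrec fun a => (C a).slack :=
  Primrec.fst.comp (Primrec.snd.comp (Primrec.snd.comp (Primrec.snd.comp
    (Primrec.snd.comp (primrec_equivProd.comp hC)))))

@[fun_prop]
theorem primrec_state (hC : Primrec C) : Primrec fun a => (C a).state :=
  Primrec.fst.comp (Primrec.snd.comp (Primrec.snd.comp (Primrec.snd.comp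
    (Primrec.snd.comp (Primrec.snd.comp (primrec_equivProd.comp hC))))))

@[fun_prop]
theorem primrec_table (hC : Primrec C) : Primrec fun a => (C a).table :=
  Primrec.snd.comp (Primrec.snd.comp (Primrec.snd.comp (Primrec.snd.comp
    (Primrec.snd.comp (Primrec.snd.comp (primrec_equivProd.comp hC))))))

variable {t u v : α → ℕ} {π : α → List (List Bool)} {o : α → Option (List Bool)}

@[fun_prop]
theorem primrec_entry (i : Fin r) (hC : Primrec C) (ht : Primrec t) (hπ : Primrec π)
    (ho : Primrec o) (hu : Primrec u) (hv : Primrec v) :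
    Primrec fun a => (C a).entry i (t a) (π a) (o a) (u a) (v a) := by
  unfold entry
  fun_prop

@[fun_prop]
theorem primrec_gram (i : Fin r) (hC : Primrec C) (ht : Primrec t) (hπ : Primrec π)
    (ho : Primrec o) (hu : Primrec u) (hv : Primrec v) :
    Primrec fun a => (C a).gram i (t a) (π a) (o a) (u a) (v a) := by
  unfold gram
  fun_prop

@[fun_prop]
theorem primrec_effectSum (i : Fin r) (hC : Primrec C) (ht : Primrec t) (hπ : Primrec π)
    (hu : Primrec u) (hv : Primrec v) :
    Primrec fun a => (C a).effectSum i (t a) (π a) (u a) (v a) := by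
  unfold effectSum
  fun_prop

@[fun_prop]
theorem primrec_admissible (i : Fin r) (hC : Primrec C) (ht : Primrec t) (hπ : Primrec π) :
    Primrec fun a => (C a).admissible i (t a) (π a) := by
  unfold admissible
  fun_prop

@[fun_prop]
theorem primrec_kraus (i : Fin r) {b : α → List Bool} (hC : Primrec C) (ht : Primrec t)
    (hπ : Primrec π) (hb : Primrec b) (hu : Primrec u) (hv : Primrec v) :
    Primrec fun a => (C a).kraus i (t a) (π a) (b a) (u a) (v a) := by
  unfold kraus
  fun_prop

theorem primrec_applyKraus {p : α → Fin r → List (List Bool)} {b : α → Fin r → List Bool}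
    {φ : α → List GaussianInt} (hC : Primrec C) (ht : Primrec t) (hp : Primrec p) (hb : Primrec b)
    (hφ : Primrec φ) : Primrec fun a => (C a).applyKraus (t a) (p a) (b a) (φ a) := by
  have hp' := fun i => Primrec.finApp i hp
  have hb' := fun i => Primrec.finApp i hb
  have h : Primrec fun x : (α × ℕ) × ℕ => ∏ i : Fin r, (C x.1.1).kraus i (t x.1.1) (p x.1.1 i)
      (b x.1.1 i) (digit (C x.1.1).dim x.1.2 i) (digit (C x.1.1).dim x.2 i) :=
    Primrec.gaussianFinProd fun i => by fun_prop
  unfold applyKraus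
  fun_prop

@[fun_prop]
theorem primrec_normSum {φ : α → List GaussianInt} (hC : Primrec C) (hφ : Primrec φ) :
    Primrec fun a => (C a).normSum r (φ a) := by
  unfold normSum
  fun_prop

@[fun_prop]
theorem primrec_denom (hC : Primrec C) : Primrec fun a => (C a).denom r := by
  unfold denom
  fun_prop

@[fun_prop]
theorem primrec_answerTuple {q : α → ℕ} (hC : Primrec C) (hq : Primrec q) :
    Primrec fun a => (C a).answerTuple r (q a) := by
  refine Primrec.finPi fun i => ?_
  unfold answerTuple
  fun_prop

end Certificate

namespace Verifier

variable {k r : ℕ} {V : Verifier k r} {α : Type*} [Primcodable α] {C : α → Certificate}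

@[fun_prop]
theorem primrec_next {e : α → V.Branch} (hC : Primrec C) (he : Primrec e) :
    Primrec fun a => Branch.next (C a) (e a) := by
  refine Primrec.finite_cases (f := fun κ a => Branch.nextOfKind (C a) (e a) κ)
    (Cfg.primrec_kind (Primrec.fst' (Primrec.snd' he))) fun κ => ?_
  cases κ with
  | halt => simp only [Branch.nextOfKind]; fun_prop
  | compute => simp only [Branch.nextOfKind]; fun_prop
  | communicate =>
    simp only [Branch.nextOfKind]
    have he' : Primrec fun x : α × ℕ => e x.1 := he.comp Primrec.fst
    have hC' : Primrec fun x : α × ℕ => C x.1 := hC.comp Primrec.fst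
    have hc : Primrec fun x : α × ℕ => (e x.1).2.1 := by fun_prop
    have hh (i : Fin r) : Primrec fun x : α × ℕ => (e x.1).2.2.1 i :=
      Primrec.finApp i (by fun_prop)
    have hm (i : Fin r) : Primrec fun x : α × ℕ => (e x.1).2.1.message i :=
      Cfg.primrec_message hc i
    have ha : Primrec fun x : α × ℕ => (C x.1).answerTuple r x.2 := by fun_prop
    have h1 : Primrec fun (x : α × ℕ) (i : Fin r) =>
        (e x.1).2.2.1 i ++ [(e x.1).2.1.message i, (C x.1).answerTuple r x.2 i] :=
      Primrec.finPi fun i => Primrec.listAppend' (hh i)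
        (Primrec.listCons' (hm i) (Primrec.listCons' (Primrec.finApp i ha) (Primrec.const [])))
    have h2 : Primrec fun (x : α × ℕ) (i : Fin r) =>
        (e x.1).2.2.1 i ++ [(e x.1).2.1.message i] :=
      Primrec.finPi fun i => Primrec.listAppend' (hh i)
        (Primrec.listCons' (hm i) (Primrec.const []))
    have h3 := Certificate.primrec_applyKraus (t := fun x => (e x.1).2.1.phases + 1)
      (φ := fun x => (e x.1).2.2.2) hC' (by fun_prop) h2 ha (by fun_prop)
    have h4 := Cfg.primrec_respond hc ha
    exact Primrec.listMap' (by fun_prop) (Primrec.prodMk' (by fun_prop)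
      (Primrec.prodMk' h4 (Primrec.prodMk' h1 h3)))

@[fun_prop]
theorem primrec_contribution {e : α → V.Branch} (hC : Primrec C) (he : Primrec e) :
    Primrec fun a => Branch.contribution (C a) (e a) := by
  unfold Branch.contribution
  fun_prop

@[fun_prop]
theorem primrec_numerator {x : α → Fin k → List Bool} (hC : Primrec C) (hx : Primrec x) :
    Primrec fun a => V.numerator (C a) (x a) := by
  unfold numerator
  have h : Primrec fun a => [((1, V.init (x a), fun _ => [], (C a).state) : V.Branch)] :=
    Primrec.listCons' (Primrec.prodMk' (Primrec.const 1) (Primrec.prodMk' (by fun_prop)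
      (Primrec.prodMk' (Primrec.const _) (by fun_prop)))) (Primrec.const [])
  exact Primrec.listSumNat' (Primrec.listMap' (Primrec.iterate' (by fun_prop) h (by fun_prop))
    (by fun_prop))

theorem primrec_certifies {x : α → Fin k → List Bool} {y : α → ℕ} (hC : Primrec C)
    (hx : Primrec x) (hy : Primrec y) : Primrec fun a => V.certifies (C a) (x a) (y a) := by
  unfold certifies
  fun_prop

end Verifier

/-! ### The value restricted to finitely many answers -/

open Filter Topology

/-- Measurement operators for `r` provers of local dimension `d`, depending on the prover, the round,
the history and the outcome. -/
abbrev KrausFamily (r d : ℕ) : Type :=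
  Fin r → ℕ → List (List Bool) → List Bool → Matrix (Fin d) (Fin d) ℂ

/-- The measurement operators of a strategy. -/
noncomputable def Strategy.kraus {r : ℕ} (S : Strategy r) : KrausFamily r S.d := fun i t π a =>
  CFC.sqrt ((S.meas i t π).effect a)

theorem tendsto_tensorMatrix {r d : ℕ} {ι : Type*} {l : Filter ι}
    {B : ι → Fin r → Matrix (Fin d) (Fin d) ℂ} {B' : Fin r → Matrix (Fin d) (Fin d) ℂ}
    (h : ∀ i, Tendsto (fun N => B N i) l (𝓝 (B' i))) :
    Tendsto (fun N => tensorMatrix (B N)) l (𝓝 (tensorMatrix B')) := by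
  refine tendsto_pi_nhds.2 fun s => tendsto_pi_nhds.2 fun s' => ?_
  simp only [tensorMatrix, Matrix.of_apply]
  exact tendsto_finsetProd _ fun i _ => tendsto_pi_nhds.1 (tendsto_pi_nhds.1 (h i) _) _

namespace Verifier

variable {k r d : ℕ} (V : Verifier k r)

open Classical in
/-- The analogue of `Verifier.acceptWithin` for arbitrary measurement operators `K`, where only the
answers in `F` are taken into account. -/
noncomputable def restrictedValue (K : KrausFamily r d) (F : Finset (List Bool)) :
    ℕ → V.Cfg → (Fin r → List (List Bool)) → EuclideanSpace ℂ (Fin r → Fin d) → ℝ≥0∞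
  | 0, c, _, φ => if c.Accepting then ‖φ‖ₑ ^ 2 else 0
  | n + 1, c, hist, φ =>
    match V.kind c.state with
    | .halt => if c.Accepting then ‖φ‖ₑ ^ 2 else 0
    | .compute => ∑ b : Bool, 2⁻¹ * restrictedValue K F n (c.computeStep b) hist φ
    | .communicate =>
      ∑ a ∈ Fintype.piFinset fun _ : Fin r => F,
        restrictedValue K F n (c.respond a) (fun i => hist i ++ [c.message i, a i])
          (Matrix.toEuclideanLin
            (tensorMatrix fun i => K i (c.phases + 1) (hist i ++ [c.message i]) (a i)) φ)

theorem restrictedValue_mono (K : KrausFamily r d) {F F' : Finset (List Bool)} (h : F ⊆ F') (n : ℕ)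
    (c : V.Cfg) (hist : Fin r → List (List Bool)) (φ : EuclideanSpace ℂ (Fin r → Fin d)) :
    V.restrictedValue K F n c hist φ ≤ V.restrictedValue K F' n c hist φ := by
  induction n generalizing c hist φ with
  | zero => exact le_rfl
  | succ n ih =>
    unfold restrictedValue
    cases V.kind c.state with
    | halt => exact le_rfl
    | compute => exact Finset.sum_le_sum fun b _ => mul_le_mul_right (ih ..) _
    | communicate =>
      exact (Finset.sum_le_sum fun a _ => ih ..).trans
        (Finset.sum_le_sum_of_subset (Fintype.piFinset_subset _ _ fun _ => h))

/-- The restriction to finitely many answers loses nothing in the limit, by monotone convergence. -/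
theorem acceptWithin_le_iSup (S : Strategy r) (n : ℕ) (c : V.Cfg)
    (hist : Fin r → List (List Bool)) (φ : EuclideanSpace ℂ (Fin r → Fin S.d)) :
    V.acceptWithin S n c hist φ ≤
      ⨆ B, V.restrictedValue S.kraus (answerList B).toFinset n c hist φ := by
  have hsub {B B' : ℕ} (h : B ≤ B') : (answerList B).toFinset ⊆ (answerList B').toFinset := by
    intro w
    simp only [List.mem_toFinset, mem_answerList]
    omega
  have hmono (n c hist φ) : Monotone fun B =>
      V.restrictedValue S.kraus (answerList B).toFinset n c hist φ :=
    fun B B' h => V.restrictedValue_mono _ (hsub h) ..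
  induction n generalizing c hist φ with
  | zero =>
    simp only [acceptWithin, restrictedValue, ciSup_const]
    exact le_rfl
  | succ n ih =>
    unfold acceptWithin restrictedValue
    cases V.kind c.state with
    | halt => simp
    | compute =>
      dsimp only
      have h (b : Bool) : Monotone fun B => 2⁻¹ *
          V.restrictedValue S.kraus (answerList B).toFinset n (c.computeStep b) hist φ :=
        fun B B' h => mul_le_mul_right (hmono _ _ _ _ h) _
      rw [← ENNReal.finsetSum_iSup_of_monotone h]
      refine Finset.sum_le_sum fun b _ => ?_
      rw [← ENNReal.mul_iSup]
      exact mul_le_mul_right (ih ..) _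
    | communicate =>
      dsimp only
      refine (ENNReal.tsum_le_tsum fun a => ih ..).trans ?_
      rw [ENNReal.tsum_eq_iSup_sum' (fun B => Fintype.piFinset fun _ => (answerList B).toFinset)]
      · refine iSup_le fun B => ?_
        rw [ENNReal.finsetSum_iSup_of_monotone fun a => hmono _ _ _ _]
        refine iSup_le fun B' => le_iSup_of_le (max B B') ?_
        exact (Finset.sum_le_sum fun a _ => hmono _ _ _ _ (le_max_right B B')).trans
          (Finset.sum_le_sum_of_subset
            (Fintype.piFinset_subset _ _ fun _ => hsub (le_max_left B B')))
      · intro T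
        refine ⟨(T.sup fun a => Finset.univ.sup fun i => Encodable.encode (a i)) + 1,
          fun a ha => ?_⟩
        simp only [Fintype.mem_piFinset, List.mem_toFinset, mem_answerList, Nat.lt_succ_iff]
        exact fun i => (Finset.le_sup (f := fun i => Encodable.encode (a i))
          (Finset.mem_univ i)).trans (Finset.le_sup
            (f := fun a : Fin r → List Bool => Finset.univ.sup fun i => Encodable.encode (a i)) ha)

open Classical in
/-- The restricted value is a continuous function of the measurement operators and the state. -/
theorem tendsto_restrictedValue {ι : Type*} {l : Filter ι} {K : ι → KrausFamily r d}
    {K' : KrausFamily r d} (hK : ∀ i t π a, Tendsto (fun N => K N i t π a) l (𝓝 (K' i t π a)))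
    (F : Finset (List Bool)) (n : ℕ) (c : V.Cfg) (hist : Fin r → List (List Bool))
    {φ : ι → EuclideanSpace ℂ (Fin r → Fin d)} {φ' : EuclideanSpace ℂ (Fin r → Fin d)}
    (hφ : Tendsto φ l (𝓝 φ')) :
    Tendsto (fun N => V.restrictedValue (K N) F n c hist (φ N)) l
      (𝓝 (V.restrictedValue K' F n c hist φ')) := by
  have hend (c : V.Cfg) {φ : ι → EuclideanSpace ℂ (Fin r → Fin d)}
      {φ' : EuclideanSpace ℂ (Fin r → Fin d)} (hφ : Tendsto φ l (𝓝 φ')) :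
      Tendsto (fun N => if c.Accepting then ‖φ N‖ₑ ^ 2 else 0) l
        (𝓝 (if c.Accepting then ‖φ'‖ₑ ^ 2 else 0)) := by
    split_ifs
    · exact ((ENNReal.continuous_pow 2).tendsto _).comp ((continuous_enorm.tendsto _).comp hφ)
    · exact tendsto_const_nhds
  induction n generalizing c hist φ φ' with
  | zero => exact hend c hφ
  | succ n ih =>
    unfold restrictedValue
    cases V.kind c.state with
    | halt => exact hend c hφ
    | compute =>
      exact tendsto_finsetSum _ fun b _ =>
        ENNReal.Tendsto.const_mul (ih _ _ hφ) (Or.inr (by simp))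
    | communicate =>
      refine tendsto_finsetSum _ fun a _ => ih _ _ ?_
      have hc : Continuous fun p : Matrix (Fin r → Fin d) (Fin r → Fin d) ℂ ×
          EuclideanSpace ℂ (Fin r → Fin d) => Matrix.toEuclideanLin p.1 p.2 := by
        simp only [Matrix.toLpLin_apply]
        fun_prop
      have hM := tendsto_tensorMatrix fun i =>
        hK i (c.phases + 1) (hist i ++ [c.message i]) (a i)
      have h := (hc.tendsto (tensorMatrix fun i =>
        K' i (c.phases + 1) (hist i ++ [c.message i]) (a i), φ')).comp (hM.prodMk_nhds hφ)
      exact h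

/-- The restricted value is a quadratic function of the state. -/
theorem restrictedValue_smul (K : KrausFamily r d) (F : Finset (List Bool)) (n : ℕ) (c : V.Cfg)
    (hist : Fin r → List (List Bool)) (z : ℂ) (φ : EuclideanSpace ℂ (Fin r → Fin d)) :
    V.restrictedValue K F n c hist (z • φ) = ‖z‖ₑ ^ 2 * V.restrictedValue K F n c hist φ := by
  induction n generalizing c hist φ with
  | zero => simp [restrictedValue, enorm_smul, mul_pow]
  | succ n ih =>
    unfold restrictedValue
    cases V.kind c.state with
    | halt => simp [enorm_smul, mul_pow]
    | compute =>
      simp only [ih, Finset.mul_sum]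
      exact Finset.sum_congr rfl fun b _ => mul_left_comm ..
    | communicate => simp only [map_smul, ih, Finset.mul_sum]

end Verifier

/-! ### Strategies from measurement operators -/

/-- Positive semidefinite measurement operators for the outcomes in `F` whose effects sum up to at most
`1` form a POVM, when an outcome outside of `F` takes the remainder. -/
noncomputable def POVM.ofSubnormalized {d : ℕ} (K : List Bool → Matrix (Fin d) (Fin d) ℂ)
    (F : Finset (List Bool)) (hK : ∀ a, (K a).PosSemidef) (hsum : ∑ a ∈ F, K a * K a ≤ 1) :
    POVM d where
  effect a := if a ∈ F then K a * K a
    else if a = (Infinite.exists_notMem_finset F).choose then 1 - ∑ a ∈ F, K a * K a else 0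
  posSemidef a := by
    split_ifs
    · have h := Matrix.posSemidef_conjTranspose_mul_self (K a)
      rwa [(hK a).isHermitian.eq] at h
    · exact hsum
    · exact Matrix.PosSemidef.zero
  hasSum_one := by
    set a₀ := (Infinite.exists_notMem_finset F).choose with ha₀
    have hnot : a₀ ∉ F := (Infinite.exists_notMem_finset F).choose_spec
    set f : List Bool → Matrix (Fin d) (Fin d) ℂ := fun a => if a ∈ F then K a * K a
        else if a = a₀ then 1 - ∑ a ∈ F, K a * K a else 0 with hf
    have h : HasSum f (∑ a ∈ insert a₀ F, f a) := hasSum_sum_of_ne_finset_zero fun a ha => by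
      simp only [Finset.mem_insert, not_or] at ha
      simp [hf, ha.1, ha.2]
    have h₀ : f a₀ = 1 - ∑ a ∈ F, K a * K a := by simp [hf, hnot]
    have h₁ : ∑ a ∈ F, f a = ∑ a ∈ F, K a * K a :=
      Finset.sum_congr rfl fun a ha => by simp [hf, ha]
    rw [Finset.sum_insert hnot, h₀, h₁, sub_add_cancel] at h
    exact h

/-- The strategy with prescribed measurement operators for the answers in `F`. -/
noncomputable def Strategy.ofKraus {r d : ℕ} (K : KrausFamily r d) (F : Finset (List Bool))
    (hK : ∀ i t π a, (K i t π a).PosSemidef) (hsum : ∀ i t π, ∑ a ∈ F, K i t π a * K i t π a ≤ 1)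
    (ψ : EuclideanSpace ℂ (Fin r → Fin d)) (hψ : ‖ψ‖ = 1) : Strategy r where
  d := d
  ψ := ψ
  norm_ψ := hψ
  meas i t π := POVM.ofSubnormalized (K i t π) F (hK i t π) (hsum i t π)

theorem Strategy.kraus_ofKraus {r d : ℕ} (K : KrausFamily r d) (F : Finset (List Bool))
    (hK : ∀ i t π a, (K i t π a).PosSemidef) (hsum : ∀ i t π, ∑ a ∈ F, K i t π a * K i t π a ≤ 1)
    (ψ : EuclideanSpace ℂ (Fin r → Fin d)) (hψ : ‖ψ‖ = 1) (i : Fin r) (t : ℕ)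
    (π : List (List Bool)) {a : List Bool} (ha : a ∈ F) :
    (Strategy.ofKraus K F hK hsum ψ hψ).kraus i t π a = K i t π a := by
  have h : ((Strategy.ofKraus K F hK hsum ψ hψ).meas i t π).effect a = K i t π a * K i t π a :=
    if_pos ha
  rw [Strategy.kraus, h]
  exact CFC.sqrt_mul_self _ (hK ..).nonneg

/-- A strategy with measurement operators `K` for the answers in `F` accepts at least with the restricted
probability, since the other answers only add to it. -/
theorem Verifier.restrictedValue_le_acceptWithin {k r : ℕ} (V : Verifier k r) (S : Strategy r)
    (K : KrausFamily r S.d) (F : Finset (List Bool))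
    (hK : ∀ i t π, ∀ a ∈ F, S.kraus i t π a = K i t π a) (n : ℕ) (c : V.Cfg)
    (hist : Fin r → List (List Bool)) (φ : EuclideanSpace ℂ (Fin r → Fin S.d)) :
    V.restrictedValue K F n c hist φ ≤ V.acceptWithin S n c hist φ := by
  induction n generalizing c hist φ with
  | zero => exact le_rfl
  | succ n ih =>
    unfold Verifier.acceptWithin Verifier.restrictedValue
    cases V.kind c.state with
    | halt => exact le_rfl
    | compute => exact Finset.sum_le_sum fun b _ => mul_le_mul_right (ih ..) _
    | communicate =>
      refine le_trans (Finset.sum_le_sum fun a ha => ?_) (ENNReal.sum_le_tsum _)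
      have h : (tensorMatrix fun i => K i (c.phases + 1) (hist i ++ [c.message i]) (a i)) =
          tensorMatrix fun i => CFC.sqrt
            ((S.meas i (c.phases + 1) (hist i ++ [c.message i])).effect (a i)) :=
        congrArg _ (funext fun i => (hK i _ _ _ (Fintype.mem_piFinset.1 ha i)).symm)
      rw [h]
      exact ih ..

/-! ### The integer evaluation computes the restricted value -/

/-- A Hermitian matrix with small entries is small in the Loewner order. -/
theorem Matrix.IsHermitian.le_smul_one {d : ℕ} {E : Matrix (Fin d) (Fin d) ℂ} (hE : E.IsHermitian)
    {D : ℝ} (h : ∀ u v, ‖E u v‖ * d ≤ D) : E ≤ (D : ℂ) • 1 := by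
  rw [Matrix.le_iff]
  have hH : ((D : ℂ) • (1 : Matrix (Fin d) (Fin d) ℂ) - E).IsHermitian := by
    refine Matrix.IsHermitian.sub ?_ hE
    rw [Matrix.IsHermitian, Matrix.conjTranspose_smul]
    simp
  refine Matrix.PosSemidef.of_dotProduct_mulVec_nonneg hH fun x => ?_
  refine Complex.nonneg_iff.2 ⟨?_, (hH.im_star_dotProduct_mulVec_self x).symm⟩
  rcases Nat.eq_zero_or_pos d with rfl | hd
  · simp
  have hd' : (0 : ℝ) < d := by exact_mod_cast hd
  have h1 : star x ⬝ᵥ (((D : ℂ) • (1 : Matrix (Fin d) (Fin d) ℂ)).mulVec x) =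
      ((∑ u, D * ‖x u‖ ^ 2 : ℝ) : ℂ) := by
    simp only [Matrix.smul_mulVec, Matrix.one_mulVec, dotProduct, Pi.smul_apply, Pi.star_apply,
      smul_eq_mul, Complex.ofReal_sum]
    refine Finset.sum_congr rfl fun u _ => ?_
    have := Complex.conj_mul' (x u)
    simp only [RCLike.star_def]
    push_cast
    rw [← this]; ring
  have h2 : (star x ⬝ᵥ E.mulVec x).re ≤ ∑ u, ∑ v, D / d * ((‖x u‖ ^ 2 + ‖x v‖ ^ 2) / 2) := by
    simp only [dotProduct, Matrix.mulVec, Finset.mul_sum, Complex.re_sum]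
    refine Finset.sum_le_sum fun u _ => Finset.sum_le_sum fun v _ => ?_
    refine (Complex.re_le_norm _).trans ?_
    rw [norm_mul, norm_mul, Pi.star_apply, norm_star]
    have he : ‖E u v‖ ≤ D / d := (le_div_iff₀ hd').2 (h u v)
    have hx : ‖x u‖ * ‖x v‖ ≤ (‖x u‖ ^ 2 + ‖x v‖ ^ 2) / 2 := by
      nlinarith [sq_nonneg (‖x u‖ - ‖x v‖)]
    calc ‖x u‖ * (‖E u v‖ * ‖x v‖) = ‖E u v‖ * (‖x u‖ * ‖x v‖) := by ring
      _ ≤ D / d * ((‖x u‖ ^ 2 + ‖x v‖ ^ 2) / 2) :=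
        mul_le_mul he hx (by positivity) ((norm_nonneg _).trans he)
  have h3 : ∑ u, ∑ v, D / d * ((‖x u‖ ^ 2 + ‖x v‖ ^ 2) / 2) = ∑ u, D * ‖x u‖ ^ 2 := by
    simp only [← Finset.mul_sum, ← Finset.sum_div, Finset.sum_add_distrib, Finset.sum_const,
      Finset.card_univ, Fintype.card_fin, nsmul_eq_mul]
    field_simp
    ring
  rw [Matrix.sub_mulVec, dotProduct_sub, h1, Complex.sub_re, Complex.ofReal_re]
  linarith

theorem enorm_sq_eq_ofReal {E : Type*} [SeminormedAddCommGroup E] (x : E) :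
    ‖x‖ₑ ^ 2 = ENNReal.ofReal (‖x‖ ^ 2) := by
  rw [ENNReal.ofReal_pow (norm_nonneg _), ofReal_norm]

theorem norm_toNat_cast (z : GaussianInt) : ((z.norm.toNat : ℕ) : ℝ) = ‖(z : ℂ)‖ ^ 2 := by
  have h : ((z.norm.toNat : ℕ) : ℤ) = z.norm := Int.toNat_of_nonneg (GaussianInt.norm_nonneg z)
  rw [← Complex.normSq_eq_norm_sq, ← GaussianInt.intCast_real_norm]
  exact_mod_cast congrArg (Int.cast (R := ℝ)) h

theorem digit_finFunctionFinEquiv {m n : ℕ} (s : Fin n → Fin m) (i : Fin n) :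
    digit m (finFunctionFinEquiv s) i = s i := by
  conv_rhs => rw [← finFunctionFinEquiv.symm_apply_apply s]
  rfl

theorem sum_range_pow_eq_sum_tuples {M : Type*} [AddCommMonoid M] (m n : ℕ) (f : ℕ → M) :
    ∑ s ∈ Finset.range (m ^ n), f s = ∑ s : Fin n → Fin m, f (finFunctionFinEquiv s) := by
  rw [Finset.sum_range]
  exact (Equiv.sum_comp finFunctionFinEquiv fun s : Fin (m ^ n) => f s).symm

theorem tensorMatrix_smul {r d : ℕ} (z : ℂ) (B : Fin r → Matrix (Fin d) (Fin d) ℂ) :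
    tensorMatrix (fun i => z • B i) = z ^ r • tensorMatrix B := by
  ext s s'
  simp [tensorMatrix, Finset.prod_mul_distrib]

namespace Certificate

variable (C : Certificate) {r : ℕ}

/-- The vector with the given list of coordinates. -/
noncomputable def vec (r : ℕ) (φ : List GaussianInt) : EuclideanSpace ℂ (Fin r → Fin C.dim) :=
  WithLp.toLp 2 fun s => ((φ.getD (finFunctionFinEquiv s) 0 : GaussianInt) : ℂ)

/-- The matrix `Lᴴ * L` that belongs to the outcome `a`. -/
noncomputable def gramMatrix (i : Fin r) (t : ℕ) (π : List (List Bool)) (a : Option (List Bool)) :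
    Matrix (Fin C.dim) (Fin C.dim) ℂ :=
  Matrix.of fun u v => ((C.gram i t π a u v : GaussianInt) : ℂ)

/-- The measurement operators that are described by the certificate. -/
noncomputable def krausFamily : KrausFamily r C.dim := fun i t π a =>
  (((C.scale + 1 : ℕ) : ℂ) ^ 2)⁻¹ • Matrix.of fun (u v : Fin C.dim) =>
    ((C.kraus i t π a u v : GaussianInt) : ℂ)

theorem enorm_vec_sq (φ : List GaussianInt) : ‖C.vec r φ‖ₑ ^ 2 = C.normSum r φ := by
  rw [enorm_sq_eq_ofReal, EuclideanSpace.norm_sq_eq, normSum, sum_range_pow_eq_sum_tuples,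
    ← ENNReal.ofReal_natCast]
  push_cast
  simp only [norm_toNat_cast, vec]

/-- `Certificate.applyKraus` is the action of a tensor product, since the numbers below `dim ^ r` list the
product basis through their digits. -/
theorem vec_applyKraus (t : ℕ) (π : Fin r → List (List Bool)) (a : Fin r → List Bool)
    (φ : List GaussianInt) :
    C.vec r (C.applyKraus t π a φ) = Matrix.toEuclideanLin
      (tensorMatrix fun i => Matrix.of fun (u v : Fin C.dim) =>
        ((C.kraus i t (π i) (a i) u v : GaussianInt) : ℂ)) (C.vec r φ) := by
  ext s
  rw [Matrix.ofLp_toLpLin, Matrix.toLin'_apply]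
  simp only [vec, applyKraus, Matrix.mulVec, dotProduct, tensorMatrix, Matrix.of_apply]
  rw [List.getD_eq_getElem _ _ (by rw [List.length_map, List.length_range]; exact (finFunctionFinEquiv s).2),
    List.getElem_map, List.getElem_range, sum_range_pow_eq_sum_tuples,
    map_sum]
  simp only [map_mul, map_prod, digit_finFunctionFinEquiv]

theorem sum_piFinset_answerList {M : Type*} [AddCommMonoid M] (f : (Fin r → List Bool) → M) :
    ∑ a ∈ Fintype.piFinset fun _ : Fin r => (answerList C.bound).toFinset, f a =
      ∑ q ∈ Finset.range ((answerList C.bound).length ^ r), f (C.answerTuple r q) := by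
  rw [sum_range_pow_eq_sum_tuples]
  symm
  refine Finset.sum_bij (fun (s : Fin r → Fin (answerList C.bound).length) _ i =>
    (answerList C.bound).get (s i)) ?_ ?_ ?_ ?_
  · intro s _
    simp [Fintype.mem_piFinset]
  · intro s _ s' _ h
    funext i
    exact (answerList_nodup C.bound).injective_get (congrFun h i)
  · intro a ha
    simp only [Fintype.mem_piFinset, List.mem_toFinset] at ha
    choose s hs using fun i => List.get_of_mem (ha i)
    exact ⟨s, Finset.mem_univ _, funext hs⟩
  · intro s _
    congr 1
    funext i
    rw [answerTuple, digit_finFunctionFinEquiv, List.getD_eq_getElem _ _ (s i).2]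
    rfl

end Certificate

namespace Verifier

variable {k r : ℕ} (V : Verifier k r) (C : Certificate)

open Classical in
theorem restrictedValue_of_halted {d : ℕ} (K : KrausFamily r d) (F : Finset (List Bool)) (n : ℕ)
    {c : V.Cfg} (hc : V.kind c.state = .halt) (hist : Fin r → List (List Bool))
    (φ : EuclideanSpace ℂ (Fin r → Fin d)) :
    V.restrictedValue K F n c hist φ = if c.Accepting then ‖φ‖ₑ ^ 2 else 0 := by
  cases n with
  | zero => rfl
  | succ n => rw [restrictedValue, hc]

/-- The probability of acceptance within `n` further steps along a branch, brought to the common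
denominator. -/
noncomputable def Branch.value (n : ℕ) (e : V.Branch) : ℝ≥0∞ :=
  e.1 * ((C.denom r : ℝ≥0∞) ^ n *
    V.restrictedValue C.krausFamily (answerList C.bound).toFinset n e.2.1 e.2.2.1 (C.vec r e.2.2.2))

theorem Branch.value_zero (e : V.Branch) : Branch.value V C 0 e = Branch.contribution C e := by
  unfold Branch.value Branch.contribution restrictedValue
  by_cases h : e.2.1.Accepting <;> simp [h, C.enorm_vec_sq]

/-- One time step preserves the total value. The scaling makes up for the probability `1 / 2` of each
coin flip and for the denominators of the measurement operators. -/
theorem Branch.value_succ (n : ℕ) (e : V.Branch) :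
    Branch.value V C (n + 1) e = ((Branch.next C e).map (Branch.value V C n)).sum := by
  obtain ⟨w, c, hist, φ⟩ := e
  have hΔ : (C.denom r : ℝ≥0∞) = 2 * ((C.scale + 1 : ℕ) : ℝ≥0∞) ^ (4 * r) := by
    simp [Certificate.denom]
  unfold Branch.next
  cases hc : V.kind c.state with
  | halt =>
    simp only [Branch.nextOfKind, Branch.value, List.map_cons, List.map_nil, List.sum_cons,
      List.sum_nil, V.restrictedValue_of_halted _ _ _ hc]
    push_cast
    ring
  | compute =>
    simp only [Branch.nextOfKind, Branch.value, List.map_cons, List.map_nil, List.sum_cons,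
      List.sum_nil, restrictedValue, hc, Fintype.sum_bool, hΔ]
    have h2 : (2 : ℝ≥0∞) * 2⁻¹ = 1 := ENNReal.mul_inv_cancel (by simp) (by simp)
    push_cast
    generalize V.restrictedValue _ _ n (c.computeStep true) _ _ = X
    generalize V.restrictedValue _ _ n (c.computeStep false) _ _ = Y
    generalize ((C.scale : ℝ≥0∞) + 1) ^ (4 * r) = P
    calc _ = (2 * 2⁻¹) * (w * ((2 * P) ^ n * P * (X + Y))) := by ring
      _ = _ := by rw [h2]; ring
  | communicate =>
    simp only [Branch.nextOfKind, Branch.value, restrictedValue, hc, List.map_map]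
    rw [C.sum_piFinset_answerList]
    change _ = ∑ q ∈ Finset.range _, _
    rw [Finset.mul_sum, Finset.mul_sum]
    refine Finset.sum_congr rfl fun q _ => ?_
    simp only [Function.comp_apply, Branch.value, C.vec_applyKraus]
    have hK : (tensorMatrix fun i => C.krausFamily i (c.phases + 1) (hist i ++ [c.message i])
        (C.answerTuple r q i)) = ((((C.scale + 1 : ℕ) : ℂ) ^ 2)⁻¹) ^ r • tensorMatrix fun i =>
          Matrix.of fun (u v : Fin C.dim) => ((C.kraus i (c.phases + 1) (hist i ++ [c.message i])
            (C.answerTuple r q i) u v : GaussianInt) : ℂ) :=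
      tensorMatrix_smul _ _
    rw [hK, map_smul, LinearMap.smul_apply, restrictedValue_smul]
    set X := V.restrictedValue C.krausFamily (answerList C.bound).toFinset n
      (c.respond (C.answerTuple r q)) (fun i => hist i ++ [c.message i, C.answerTuple r q i]) _
    -- the factor from the denominators of the measurement operators
    have hz : ((C.scale + 1 : ℕ) : ℝ≥0∞) ^ (4 * r) *
        ‖((((C.scale + 1 : ℕ) : ℂ) ^ 2)⁻¹) ^ r‖ₑ ^ 2 = 1 := by
      have h0 : ((C.scale + 1 : ℕ) : ℂ) ≠ 0 := Nat.cast_ne_zero.2 (Nat.succ_ne_zero _)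
      have h1 : ((C.scale + 1 : ℕ) : ℝ≥0∞) = ‖((C.scale + 1 : ℕ) : ℂ)‖ₑ := by
        rw [← ofReal_norm, Complex.norm_natCast, ENNReal.ofReal_natCast]
      rw [h1, ← enorm_pow, ← enorm_pow, ← enorm_mul]
      have h2 : ((C.scale + 1 : ℕ) : ℂ) ^ (4 * r) * (((((C.scale + 1 : ℕ) : ℂ) ^ 2)⁻¹) ^ r) ^ 2 = 1 := by
        rw [← inv_pow, ← pow_mul, ← pow_mul, inv_pow, show 2 * (r * 2) = 4 * r by ring]
        exact mul_inv_cancel₀ (pow_ne_zero _ h0)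
      rw [h2, enorm_one]
    rw [pow_succ, hΔ]
    generalize ((C.scale + 1 : ℕ) : ℝ≥0∞) ^ (4 * r) = P at hz ⊢
    generalize ‖((((C.scale + 1 : ℕ) : ℂ) ^ 2)⁻¹) ^ r‖ₑ ^ 2 = Q at hz ⊢
    push_cast
    calc _ = (P * Q) * (2 * w * ((2 * P) ^ n * X)) := by ring
      _ = _ := by rw [hz, one_mul]

/-- The total contribution after `n` simulated steps is the total value of the branches at the start. -/
theorem sum_contribution_iterate (n : ℕ) (l : List V.Branch) :
    ((((List.flatMap (Branch.next C))^[n] l).map (Branch.contribution C)).sum : ℕ) =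
      (l.map (Branch.value V C n)).sum := by
  induction n generalizing l with
  | zero =>
    simp only [Function.iterate_zero, id_eq]
    induction l with
    | nil => simp
    | cons e l ih => simp [ih, Branch.value_zero]
  | succ n ih =>
    rw [Function.iterate_succ_apply, ih]
    induction l with
    | nil => simp
    | cons e l ih' =>
      rw [List.flatMap_cons, List.map_append, List.sum_append, ih', List.map_cons, List.sum_cons,
        Branch.value_succ]

theorem numerator_eq (x : Fin k → List Bool) :
    (V.numerator C x : ℝ≥0∞) = (C.denom r : ℝ≥0∞) ^ C.fuel *
      V.restrictedValue C.krausFamily (answerList C.bound).toFinset C.fuel (V.init x) (fun _ => [])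
        (C.vec r C.state) := by
  rw [numerator, sum_contribution_iterate]
  simp [Branch.value]

/-- The integer test compares the value of the described strategy with `y / (y + 1)`, where both sides
are multiplied by the squared norm of the shared state. -/
theorem certifies_iff (x : Fin k → List Bool) (y : ℕ) :
    V.certifies C x y = true ↔ y * ‖C.vec r C.state‖ₑ ^ 2 < (y + 1) *
      V.restrictedValue C.krausFamily (answerList C.bound).toFinset C.fuel (V.init x) (fun _ => [])
        (C.vec r C.state) := by
  rw [certifies, decide_eq_true_iff, ← Nat.cast_lt (α := ℝ≥0∞)]
  push_cast
  rw [numerator_eq, ← C.enorm_vec_sq, mul_left_comm, mul_left_comm ((y : ℝ≥0∞) + 1)]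
  refine ENNReal.mul_lt_mul_iff_right (pow_ne_zero _ ?_) (ENNReal.pow_ne_top (by simp))
  simp [Certificate.denom]

end Verifier

/-! ### Soundness of certificates -/

namespace Certificate

variable (C : Certificate) {r : ℕ}

/-- The matrix of the entries of the table. -/
noncomputable def entryMatrix (i : Fin r) (t : ℕ) (π : List (List Bool)) (a : Option (List Bool)) :
    Matrix (Fin C.dim) (Fin C.dim) ℂ :=
  Matrix.of fun u v => ((C.entry i t π a u v : GaussianInt) : ℂ)

theorem gramMatrix_eq (i : Fin r) (t : ℕ) (π : List (List Bool)) (a : Option (List Bool)) :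
    C.gramMatrix i t π a = (C.entryMatrix i t π a).conjTranspose * C.entryMatrix i t π a := by
  ext u v
  simp [gramMatrix, gram, entryMatrix, Matrix.mul_apply, Finset.sum_range, GaussianInt.toComplex_star]

theorem posSemidef_gramMatrix (i : Fin r) (t : ℕ) (π : List (List Bool))
    (a : Option (List Bool)) : (C.gramMatrix i t π a).PosSemidef := by
  rw [gramMatrix_eq]
  exact Matrix.posSemidef_conjTranspose_mul_self _

/-- The sum of the effects, before the normalization. -/
noncomputable def effectSumMatrix (i : Fin r) (t : ℕ) (π : List (List Bool)) :
    Matrix (Fin C.dim) (Fin C.dim) ℂ :=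
  C.gramMatrix i t π none * C.gramMatrix i t π none + ∑ a ∈ (answerList C.bound).toFinset,
    C.gramMatrix i t π (some a) * C.gramMatrix i t π (some a)

theorem effectSumMatrix_apply (i : Fin r) (t : ℕ) (π : List (List Bool)) (u v : Fin C.dim) :
    C.effectSumMatrix i t π u v = ((C.effectSum i t π u v : GaussianInt) : ℂ) := by
  have h (a : Option (List Bool)) : (C.gramMatrix i t π a * C.gramMatrix i t π a) u v =
      ((∑ w ∈ Finset.range C.dim, C.gram i t π a u w * C.gram i t π a w v : GaussianInt) : ℂ) := by
    simp [gramMatrix, Matrix.mul_apply, Finset.sum_range]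
  rw [effectSumMatrix, effectSum, List.map_cons, List.sum_cons, map_add, Matrix.add_apply, h,
    Matrix.sum_apply, List.sum_toFinset _ (answerList_nodup _), map_list_sum, List.map_map,
    List.map_map]
  simp only [h]
  rfl

theorem isHermitian_effectSumMatrix (i : Fin r) (t : ℕ) (π : List (List Bool)) :
    (C.effectSumMatrix i t π).IsHermitian := by
  have h (a : Option (List Bool)) :
      (C.gramMatrix i t π a * C.gramMatrix i t π a).IsHermitian := by
    have := (C.posSemidef_gramMatrix i t π a).isHermitian
    rw [Matrix.IsHermitian, Matrix.conjTranspose_mul, this.eq]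
  unfold effectSumMatrix
  refine (h none).add ?_
  rw [Matrix.IsHermitian, Matrix.conjTranspose_sum]
  exact Finset.sum_congr rfl fun a _ => (h (some a)).eq

/-- The matrix `(slack + 1) * Z - slack * D * 1`, where `Z` is the sum of the effects and `D` is the
common denominator `(scale + 1) ^ 4`. -/
noncomputable def defectMatrix (i : Fin r) (t : ℕ) (π : List (List Bool)) :
    Matrix (Fin C.dim) (Fin C.dim) ℂ :=
  ((C.slack + 1 : ℕ) : ℂ) • C.effectSumMatrix i t π -
    ((C.slack * (C.scale + 1) ^ 4 : ℕ) : ℂ) • 1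

theorem admissible_iff (i : Fin r) (t : ℕ) (π : List (List Bool)) :
    C.admissible i t π = true ↔ ∀ u v : Fin C.dim,
      ‖C.defectMatrix i t π u v‖ * C.dim ≤
          (C.scale + 1 : ℝ) ^ 4 := by
  have key (u v : Fin C.dim) : ((((C.slack + 1 : ℕ) : GaussianInt) * C.effectSum i t π u v -
      bif decide ((u : ℕ) = v) then ((C.slack * (C.scale + 1) ^ 4 : ℕ) : GaussianInt)
        else 0).norm.toNat * C.dim ^ 2 ≤ ((C.scale + 1) ^ 4) ^ 2) ↔
      ‖C.defectMatrix i t π u v‖ * C.dim ≤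
          (C.scale + 1 : ℝ) ^ 4 := by
    rw [← Nat.cast_le (α := ℝ), Nat.cast_mul, norm_toNat_cast, Nat.cast_pow, Nat.cast_pow,
      Nat.cast_pow, ← mul_pow, pow_le_pow_iff_left₀ (by positivity) (by positivity) two_ne_zero]
    have h : ((((C.slack + 1 : ℕ) : GaussianInt) * C.effectSum i t π u v -
        bif decide ((u : ℕ) = v) then ((C.slack * (C.scale + 1) ^ 4 : ℕ) : GaussianInt)
          else 0 : GaussianInt) : ℂ) = C.defectMatrix i t π u v := by
      rw [defectMatrix, Matrix.sub_apply, Matrix.smul_apply, Matrix.smul_apply, effectSumMatrix_apply, map_sub,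
        map_mul, map_natCast]
      by_cases huv : u = v
      · subst huv
        simp
      · simp [huv, Fin.val_inj]
    rw [h]
    push_cast
    rfl
  simp only [← key]
  simp only [admissible, List.all_eq_true, List.mem_range, decide_eq_true_eq]
  exact ⟨fun h u v => h u u.2 v v.2, fun h u hu v hv => h ⟨u, hu⟩ ⟨v, hv⟩⟩

/-- If the test succeeds, the deviation of `(slack + 1) * Z` from `slack * D * 1` is at most `D * 1`, and
hence `Z` is at most `D * 1`. -/
theorem effectSumMatrix_le (i : Fin r) (t : ℕ) (π : List (List Bool))
    (h : C.admissible i t π = true) :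
    C.effectSumMatrix i t π ≤ (((C.scale + 1 : ℕ) : ℝ) ^ 4 : ℝ) • 1 := by
  rw [admissible_iff] at h
  set D : ℝ := ((C.scale + 1 : ℕ) : ℝ) ^ 4 with hD
  have hE : (C.defectMatrix i t π).IsHermitian := by
    unfold defectMatrix
    refine Matrix.IsHermitian.sub ?_ ?_
    · rw [Matrix.IsHermitian, Matrix.conjTranspose_smul, (C.isHermitian_effectSumMatrix i t π).eq]
      simp
    · rw [Matrix.IsHermitian, Matrix.conjTranspose_smul]
      simp
  have h1 := hE.le_smul_one (D := D) fun u v => by simpa [hD] using h u v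
  rw [Matrix.le_iff] at h1 ⊢
  have hq : (0 : ℝ) ≤ ((C.slack : ℝ) + 1)⁻¹ := by positivity
  have h2 := h1.smul hq
  have hq0 : (C.slack : ℝ) + 1 ≠ 0 := by positivity
  convert h2 using 1
  ext u v
  simp only [defectMatrix, Matrix.sub_apply, Matrix.smul_apply, Complex.real_smul, smul_eq_mul, hD]
  push_cast
  have hq1 : (C.slack : ℂ) + 1 ≠ 0 := by exact_mod_cast hq0
  field_simp
  ring

theorem krausFamily_of_admissible {i : Fin r} {t : ℕ} {π : List (List Bool)}
    (h : C.admissible i t π = true) (a : List Bool) :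
    C.krausFamily i t π a = (((C.scale + 1 : ℕ) : ℂ) ^ 2)⁻¹ • C.gramMatrix i t π (some a) := by
  simp [krausFamily, kraus, h, gramMatrix]

theorem krausFamily_of_not_admissible {i : Fin r} {t : ℕ} {π : List (List Bool)}
    (h : ¬ C.admissible i t π = true) (a : List Bool) : C.krausFamily i t π a = 0 := by
  ext u v
  simp [krausFamily, kraus, h]

theorem posSemidef_krausFamily (i : Fin r) (t : ℕ) (π : List (List Bool)) (a : List Bool) :
    (C.krausFamily i t π a).PosSemidef := by
  by_cases h : C.admissible i t π = true
  · rw [krausFamily_of_admissible C h]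
    have h1 : (0 : ℝ) ≤ (((C.scale + 1 : ℕ) : ℝ) ^ 2)⁻¹ := by positivity
    convert (C.posSemidef_gramMatrix i t π (some a)).smul h1 using 1
    ext u v
    simp
  · rw [krausFamily_of_not_admissible C h]
    exact Matrix.PosSemidef.zero

theorem sum_krausFamily_le (i : Fin r) (t : ℕ) (π : List (List Bool)) :
    ∑ a ∈ (answerList C.bound).toFinset, C.krausFamily i t π a * C.krausFamily i t π a ≤ 1 := by
  by_cases h : C.admissible i t π = true
  · simp only [krausFamily_of_admissible C h, Matrix.smul_mul, Matrix.mul_smul, ← Finset.smul_sum]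
    have h0 : (0 : Matrix (Fin C.dim) (Fin C.dim) ℂ) ≤
        C.gramMatrix i t π none * C.gramMatrix i t π none := by
      have := Matrix.posSemidef_conjTranspose_mul_self (C.gramMatrix i t π none)
      rw [(C.posSemidef_gramMatrix i t π none).isHermitian.eq] at this
      exact this.nonneg
    have h1 : ∑ a ∈ (answerList C.bound).toFinset,
        C.gramMatrix i t π (some a) * C.gramMatrix i t π (some a) ≤
          (((C.scale + 1 : ℕ) : ℝ) ^ 4 : ℝ) • 1 :=
      le_trans (le_add_of_nonneg_left h0) (C.effectSumMatrix_le i t π h)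
    rw [Matrix.le_iff] at h1 ⊢
    have h2 : (0 : ℝ) ≤ (((C.scale + 1 : ℕ) : ℝ) ^ 4)⁻¹ := by positivity
    convert h1.smul h2 using 1
    ext u v
    have h3 : ((C.scale : ℂ) + 1) ≠ 0 := by exact_mod_cast Nat.succ_ne_zero C.scale
    simp only [Matrix.sub_apply, Matrix.smul_apply, Complex.real_smul, smul_eq_mul]
    push_cast
    field_simp
  · simp [krausFamily_of_not_admissible C h]

end Certificate

namespace Verifier

variable {k r : ℕ} (V : Verifier k r)

theorem restrictedValue_le_quantumValue {d : ℕ} (K : KrausFamily r d) (F : Finset (List Bool))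
    (hK : ∀ i t π a, (K i t π a).PosSemidef) (hsum : ∀ i t π, ∑ a ∈ F, K i t π a * K i t π a ≤ 1)
    {ψ : EuclideanSpace ℂ (Fin r → Fin d)} (hψ : ‖ψ‖ = 1) (n : ℕ) (x : Fin k → List Bool) :
    V.restrictedValue K F n (V.init x) (fun _ => []) ψ ≤ V.quantumValue x :=
  (V.restrictedValue_le_acceptWithin (Strategy.ofKraus K F hK hsum ψ hψ) K F
    (fun i t π _ ha => Strategy.kraus_ofKraus K F hK hsum ψ hψ i t π ha) n _ _ ψ).trans
    (le_iSup_of_le (Strategy.ofKraus K F hK hsum ψ hψ) (le_iSup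
      (fun n => V.acceptWithin (Strategy.ofKraus K F hK hsum ψ hψ) n (V.init x) (fun _ => []) ψ) n))

/-- Certificates are sound: the measurement operators are those of a genuine strategy, after the
normalization of the shared state. -/
theorem lt_quantumValue_of_certifies {C : Certificate} {x : Fin k → List Bool} {y : ℕ}
    (h : V.certifies C x y = true) : (y : ℝ≥0∞) < (y + 1) * V.quantumValue x := by
  rw [certifies_iff] at h
  set ψ := C.vec r C.state
  -- for `ψ = 0` the strict inequality would read `0 < 0`
  have h0 : ψ ≠ 0 := by
    intro h0
    rw [h0, ← zero_smul ℂ (0 : EuclideanSpace ℂ (Fin r → Fin C.dim)), restrictedValue_smul] at h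
    simp at h
  have hn : ‖ψ‖ ≠ 0 := norm_ne_zero_iff.2 h0
  set ψ' : EuclideanSpace ℂ (Fin r → Fin C.dim) := ((‖ψ‖⁻¹ : ℝ) : ℂ) • ψ
  have h1 : ‖ψ'‖ = 1 := by
    rw [norm_smul, Complex.norm_real, norm_inv, norm_norm, inv_mul_cancel₀ hn]
  have h2 : ψ = ((‖ψ‖ : ℝ) : ℂ) • ψ' := by
    rw [smul_smul, ← Complex.ofReal_mul, mul_inv_cancel₀ hn, Complex.ofReal_one, one_smul]
  have h3 : ‖((‖ψ‖ : ℝ) : ℂ)‖ₑ = ‖ψ‖ₑ := by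
    rw [← ofReal_norm, Complex.norm_real, norm_norm, ofReal_norm]
  have hK := V.restrictedValue_le_quantumValue C.krausFamily (answerList C.bound).toFinset
    C.posSemidef_krausFamily C.sum_krausFamily_le h1 C.fuel x
  rw [h2, restrictedValue_smul, ← h2, h3, mul_comm, mul_left_comm] at h
  have h4 := lt_of_mul_lt_mul_left' h
  exact h4.trans_le (mul_le_mul_right hK _)

end Verifier

/-! ### Completeness of certificates -/

/-- The real and the imaginary part of `z`, rounded down. -/
noncomputable def GaussianInt.floor (z : ℂ) : GaussianInt :=
  ⟨⌊z.re⌋, ⌊z.im⌋⟩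

theorem GaussianInt.norm_floor_sub_le (z : ℂ) : ‖(GaussianInt.floor z : ℂ) - z‖ ≤ 2 := by
  refine (Complex.norm_le_abs_re_add_abs_im _).trans ?_
  have h (t : ℝ) : |(⌊t⌋ : ℝ) - t| ≤ 1 := by
    rw [abs_le]
    constructor <;> linarith [Int.floor_le t, Int.lt_floor_add_one t]
  have h1 := h z.re
  have h2 := h z.im
  simp only [Complex.sub_re, Complex.sub_im, GaussianInt.floor, GaussianInt.re_toComplex,
    GaussianInt.im_toComplex]
  linarith

theorem GaussianInt.tendsto_floor (z : ℂ) :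
    Tendsto (fun N : ℕ => ((N + 1 : ℕ) : ℂ)⁻¹ * (GaussianInt.floor (((N + 1 : ℕ) : ℂ) * z) : ℂ))
      atTop (𝓝 z) := by
  rw [tendsto_iff_norm_sub_tendsto_zero]
  refine squeeze_zero (g := fun N : ℕ => 2 * (1 / ((N : ℝ) + 1))) (fun _ => _root_.norm_nonneg _)
    (fun N => ?_) (by simpa using (tendsto_one_div_add_atTop_nhds_zero_nat (𝕜 := ℝ)).const_mul 2)
  have h0 : ((N + 1 : ℕ) : ℂ) ≠ 0 := Nat.cast_ne_zero.2 (Nat.succ_ne_zero _)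
  have h1 : ((N + 1 : ℕ) : ℂ)⁻¹ * (GaussianInt.floor (((N + 1 : ℕ) : ℂ) * z) : ℂ) - z =
      ((N + 1 : ℕ) : ℂ)⁻¹ * ((GaussianInt.floor (((N + 1 : ℕ) : ℂ) * z) : ℂ) -
        ((N + 1 : ℕ) : ℂ) * z) := by
    rw [mul_sub, inv_mul_cancel_left₀ h0]
  rw [h1, norm_mul, norm_inv, Complex.norm_natCast, mul_comm, one_div]
  push_cast
  exact mul_le_mul_of_nonneg_right (GaussianInt.norm_floor_sub_le _) (by positivity)

namespace Certificate

variable {r d : ℕ}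

/-- The number at position `code` of the infinite table that describes the matrices `L`. -/
noncomputable def tableEntry
    (L : Fin r → ℕ → List (List Bool) → Option (List Bool) → Matrix (Fin d) (Fin d) ℂ)
    (code : ℕ) : ℂ :=
  match Encodable.decode (α := Fin r × ℕ × List (List Bool) × Option (List Bool) × ℕ × ℕ) code with
  | some (i, t, π, a, u, v) => if h : u < d ∧ v < d then L i t π a ⟨u, h.1⟩ ⟨v, h.2⟩ else 0
  | none => 0

/-- The certificate whose first `N` table entries are those of `L`, rounded to multiples of
`1 / (N + 1)`; the coordinates of the state are rounded in the same way. -/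
noncomputable abbrev approx (n B q : ℕ)
    (L : Fin r → ℕ → List (List Bool) → Option (List Bool) → Matrix (Fin d) (Fin d) ℂ)
    (ψ : EuclideanSpace ℂ (Fin r → Fin d)) (N : ℕ) : Certificate where
  fuel := n
  dim := d
  bound := B
  scale := N
  slack := q
  state := (List.finRange (d ^ r)).map fun s =>
    GaussianInt.floor (((N + 1 : ℕ) : ℂ) * ψ (finFunctionFinEquiv.symm s))
  table := (List.range N).map fun code =>
    GaussianInt.floor (((N + 1 : ℕ) : ℂ) * tableEntry L code)

variable (n B q : ℕ)
  (L : Fin r → ℕ → List (List Bool) → Option (List Bool) → Matrix (Fin d) (Fin d) ℂ)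
  (ψ : EuclideanSpace ℂ (Fin r → Fin d))

theorem tendsto_vec_approx :
    Tendsto (fun N => ((N + 1 : ℕ) : ℂ)⁻¹ • (approx n B q L ψ N).vec r (approx n B q L ψ N).state)
      atTop (𝓝 ψ) := by
  have h : Tendsto (fun (N : ℕ) (s : Fin r → Fin d) => ((N + 1 : ℕ) : ℂ)⁻¹ *
      (GaussianInt.floor (((N + 1 : ℕ) : ℂ) * ψ s) : ℂ)) atTop (𝓝 (WithLp.ofLp ψ)) :=
    tendsto_pi_nhds.2 fun s => GaussianInt.tendsto_floor (ψ s)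
  refine (((PiLp.continuous_toLp 2 fun _ : Fin r → Fin d => ℂ).tendsto _).comp h).congr fun N => ?_
  ext s
  have h1 : (approx n B q L ψ N).state.getD (finFunctionFinEquiv s) 0 =
      GaussianInt.floor (((N + 1 : ℕ) : ℂ) * ψ s) := by
    rw [List.getD_eq_getElem _ _ (by
      rw [List.length_map, List.length_finRange]; exact (finFunctionFinEquiv s).2),
      List.getElem_map, List.getElem_finRange]
    simp
  simp only [Function.comp_apply, PiLp.smul_apply, vec, h1, smul_eq_mul]

theorem tendsto_entryMatrix_approx (i : Fin r) (t : ℕ) (π : List (List Bool))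
    (a : Option (List Bool)) :
    Tendsto (fun N => ((N + 1 : ℕ) : ℂ)⁻¹ • (approx n B q L ψ N).entryMatrix i t π a)
      atTop (𝓝 (L i t π a)) := by
  refine tendsto_pi_nhds.2 fun u => tendsto_pi_nhds.2 fun v => ?_
  set code := Encodable.encode (i, t, π, a, (u : ℕ), (v : ℕ)) with hcode
  have h : tableEntry L code = L i t π a u v := by
    simp [tableEntry, hcode]
  refine Tendsto.congr' ?_ (h ▸ GaussianInt.tendsto_floor (tableEntry L code))
  filter_upwards [eventually_gt_atTop code] with N hN
  have h1 : (approx n B q L ψ N).entry i t π a u v =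
      GaussianInt.floor (((N + 1 : ℕ) : ℂ) * tableEntry L code) := by
    rw [entry, ← hcode, List.getD_eq_getElem _ _ (by simpa using hN), List.getElem_map,
      List.getElem_range]
  simp only [Matrix.smul_apply, entryMatrix, Matrix.of_apply, h1, h, smul_eq_mul]

theorem tendsto_gramMatrix_approx (i : Fin r) (t : ℕ) (π : List (List Bool))
    (a : Option (List Bool)) :
    Tendsto (fun N => (((N + 1 : ℕ) : ℂ) ^ 2)⁻¹ • (approx n B q L ψ N).gramMatrix i t π a)
      atTop (𝓝 ((L i t π a).conjTranspose * L i t π a)) := by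
  have h := tendsto_entryMatrix_approx n B q L ψ i t π a
  have hc : Continuous fun M : Matrix (Fin d) (Fin d) ℂ => M.conjTranspose * M := by fun_prop
  refine ((hc.tendsto _).comp h).congr fun N => ?_
  simp only [Function.comp_apply, gramMatrix_eq, Matrix.conjTranspose_smul, Matrix.smul_mul,
    Matrix.mul_smul, smul_smul]
  congr 1
  simp [pow_two]

theorem tendsto_effectSumMatrix_approx (i : Fin r) (t : ℕ) (π : List (List Bool)) {z : ℂ}
    (hL : ∑ a ∈ insert none ((answerList B).toFinset.map Function.Embedding.some),
      ((L i t π a).conjTranspose * L i t π a) * ((L i t π a).conjTranspose * L i t π a) =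
        z • (1 : Matrix (Fin d) (Fin d) ℂ)) :
    Tendsto (fun N => (((N + 1 : ℕ) : ℂ) ^ 4)⁻¹ • (approx n B q L ψ N).effectSumMatrix i t π)
      atTop (𝓝 (z • (1 : Matrix (Fin d) (Fin d) ℂ))) := by
  have h := tendsto_gramMatrix_approx n B q L ψ i t π
  rw [Finset.sum_insert (by simp), Finset.sum_map] at hL
  rw [← hL]
  refine (((h none).mul (h none)).add (tendsto_finsetSum (answerList B).toFinset fun a _ =>
    (h (some a)).mul (h (some a)))).congr fun N => ?_
  simp only [effectSumMatrix, Matrix.smul_mul, Matrix.mul_smul, smul_smul, smul_add,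
    Finset.smul_sum]
  have h1 : (((N + 1 : ℕ) : ℂ) ^ 2)⁻¹ * (((N + 1 : ℕ) : ℂ) ^ 2)⁻¹ = (((N + 1 : ℕ) : ℂ) ^ 4)⁻¹ := by
    rw [← mul_inv, ← pow_add]
  simp only [h1]

/-- The rounded matrices pass the test from some point on: after division by `(N + 1) ^ 4` the tested
entries tend to `0`, which is strictly inside the tolerance. -/
theorem eventually_admissible_approx (i : Fin r) (t : ℕ) (π : List (List Bool))
    (hL : ∑ a ∈ insert none ((answerList B).toFinset.map Function.Embedding.some),
      ((L i t π a).conjTranspose * L i t π a) * ((L i t π a).conjTranspose * L i t π a) =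
        ((q : ℂ) / (q + 1)) • 1) :
    ∀ᶠ N in atTop, (approx n B q L ψ N).admissible i t π = true := by
  have h := tendsto_effectSumMatrix_approx n B q L ψ i t π hL
  have hq : (q : ℂ) + 1 ≠ 0 := by exact_mod_cast Nat.succ_ne_zero q
  have h1 (u v : Fin d) : Tendsto (fun N =>
      ‖(((N + 1 : ℕ) : ℂ) ^ 4)⁻¹ * (approx n B q L ψ N).defectMatrix i t π u v‖ * d) atTop
      (𝓝 0) := by
    have h2 := ((continuous_id.matrix_elem u v).tendsto _).comp h
    have h3 := ((h2.const_mul ((q : ℂ) + 1)).sub_const ((q : ℂ) * (1 : Matrix (Fin d) (Fin d) ℂ) u v))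
    have h4 : ((q : ℂ) + 1) * (((q : ℂ) / (q + 1)) • (1 : Matrix (Fin d) (Fin d) ℂ)) u v -
        (q : ℂ) * (1 : Matrix (Fin d) (Fin d) ℂ) u v = 0 := by
      simp only [Matrix.smul_apply, smul_eq_mul]
      field_simp
      ring
    have h5 := (h3.norm).mul_const (d : ℝ)
    simp only [id_eq] at h5
    rw [h4, norm_zero, zero_mul] at h5
    refine h5.congr fun N => ?_
    congr 2
    simp only [Function.comp_apply, defectMatrix, Matrix.sub_apply, Matrix.smul_apply, smul_eq_mul]
    have hN : (N : ℂ) + 1 ≠ 0 := by exact_mod_cast Nat.succ_ne_zero N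
    push_cast
    field_simp
  have h6 : ∀ᶠ N in atTop, ∀ u v : Fin d,
      ‖(((N + 1 : ℕ) : ℂ) ^ 4)⁻¹ * (approx n B q L ψ N).defectMatrix i t π u v‖ * d < 1 :=
    eventually_all.2 fun u => eventually_all.2 fun v => (h1 u v).eventually_lt_const one_pos
  filter_upwards [h6] with N hN
  rw [admissible_iff]
  intro u v
  have h7 := (hN u v).le
  rw [norm_mul, norm_inv, norm_pow, Complex.norm_natCast, mul_assoc,
    inv_mul_le_iff₀ (by positivity), mul_one] at h7
  exact_mod_cast h7

theorem tendsto_krausFamily_approx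
    (hL : ∀ i t π, ∑ a ∈ insert none ((answerList B).toFinset.map Function.Embedding.some),
      ((L i t π a).conjTranspose * L i t π a) * ((L i t π a).conjTranspose * L i t π a) =
        ((q : ℂ) / (q + 1)) • 1) (i : Fin r) (t : ℕ) (π : List (List Bool)) (a : List Bool) :
    Tendsto (fun N => (approx n B q L ψ N).krausFamily i t π a) atTop
      (𝓝 ((L i t π (some a)).conjTranspose * L i t π (some a))) := by
  refine (tendsto_gramMatrix_approx n B q L ψ i t π (some a)).congr' ?_
  filter_upwards [eventually_admissible_approx n B q L ψ i t π (hL i t π)] with N hN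
  rw [krausFamily_of_admissible _ hN]

end Certificate

/-- Partial sums of the effects lie below `1`, since positive semidefiniteness can be tested on the
(continuous) quadratic forms `A ↦ ⟨x, A x⟩`. -/
theorem POVM.sum_effect_le_one {d : ℕ} (M : POVM d) (F : Finset (List Bool)) :
    ∑ a ∈ F, M.effect a ≤ 1 := by
  rw [Matrix.le_iff]
  have hH : (∑ a ∈ F, M.effect a).IsHermitian := by
    rw [Matrix.IsHermitian, Matrix.conjTranspose_sum]
    exact Finset.sum_congr rfl fun a _ => (M.posSemidef a).isHermitian
  refine Matrix.PosSemidef.of_dotProduct_mulVec_nonneg (Matrix.isHermitian_one.sub hH) fun x => ?_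
  let f : Matrix (Fin d) (Fin d) ℂ →+ ℂ :=
    { toFun := fun A => star x ⬝ᵥ A.mulVec x
      map_zero' := by simp
      map_add' := fun A A' => by rw [Matrix.add_mulVec, dotProduct_add] }
  have hf : Continuous f := by
    change Continuous fun A : Matrix (Fin d) (Fin d) ℂ => star x ⬝ᵥ A.mulVec x
    fun_prop
  have h := sum_le_hasSum F (fun a _ => (M.posSemidef a).dotProduct_mulVec_nonneg x)
    (M.hasSum_one.map f hf)
  rw [Matrix.sub_mulVec, dotProduct_sub]
  exact sub_nonneg.2 ((map_sum f _ _).trans_le h)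

/-- A factorization of the measurement operators of a strategy, scaled down by the square root of
`q / (q + 1)`, together with one for an additional outcome that makes the sum over the answers in `F`
complete. -/
theorem Strategy.exists_factorization {r : ℕ} (S : Strategy r) (F : Finset (List Bool)) (q : ℕ) :
    ∃ L : Fin r → ℕ → List (List Bool) → Option (List Bool) → Matrix (Fin S.d) (Fin S.d) ℂ,
      (∀ i t π a, (L i t π (some a)).conjTranspose * L i t π (some a) =
        √((q : ℝ) / (q + 1)) • S.kraus i t π a) ∧
      ∀ i t π, ∑ a ∈ insert none (F.map Function.Embedding.some),
        ((L i t π a).conjTranspose * L i t π a) * ((L i t π a).conjTranspose * L i t π a) =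
          ((q : ℂ) / (q + 1)) • 1 := by
  set lam : ℝ := √((q : ℝ) / (q + 1)) with hlam
  let E (i : Fin r) (t : ℕ) (π : List (List Bool)) (a : Option (List Bool)) :
      Matrix (Fin S.d) (Fin S.d) ℂ :=
    a.elim (1 - ∑ a ∈ F, (S.meas i t π).effect a) (S.meas i t π).effect
  have hE (i t π a) : 0 ≤ E i t π a := by
    cases a with
    | none =>
      exact sub_nonneg.2 ((S.meas i t π).sum_effect_le_one F)
    | some a => exact ((S.meas i t π).posSemidef a).nonneg
  let L (i : Fin r) (t : ℕ) (π : List (List Bool)) (a : Option (List Bool)) :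
      Matrix (Fin S.d) (Fin S.d) ℂ := CFC.sqrt (lam • CFC.sqrt (E i t π a))
  have hL (i t π a) : (L i t π a).conjTranspose * L i t π a = lam • CFC.sqrt (E i t π a) := by
    have h1 : (L i t π a).conjTranspose = L i t π a :=
      (Matrix.nonneg_iff_posSemidef.1 (CFC.sqrt_nonneg (lam • CFC.sqrt (E i t π a)))).isHermitian
    rw [h1]
    refine CFC.sqrt_mul_sqrt_self _ ?_
    exact ((Matrix.nonneg_iff_posSemidef.1 (CFC.sqrt_nonneg (E i t π a))).smul
      (Real.sqrt_nonneg _)).nonneg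
  refine ⟨L, fun i t π a => hL i t π (some a), fun i t π => ?_⟩
  simp only [hL, Matrix.smul_mul, Matrix.mul_smul, smul_smul]
  rw [← Finset.smul_sum, Finset.sum_congr rfl fun a _ => CFC.sqrt_mul_sqrt_self _ (hE i t π a),
    Finset.sum_insert (by simp), Finset.sum_map]
  have h2 : E i t π none + ∑ a ∈ F, E i t π (some a) = 1 := sub_add_cancel _ _
  have h3 : lam * lam = (q : ℝ) / (q + 1) := Real.mul_self_sqrt (by positivity)
  change (lam * lam) • (E i t π none + ∑ a ∈ F, E i t π (some a)) = _
  rw [h2, h3]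
  ext u v
  simp

namespace Verifier

variable {k r : ℕ} (V : Verifier k r)

/-- A quantum value above `y / (y + 1)` has a certificate. -/
theorem exists_certifies {x : Fin k → List Bool} {y : ℕ}
    (h : (y : ℝ≥0∞) < (y + 1) * V.quantumValue x) : ∃ C, V.certifies C x y = true := by
  have hy : (y : ℝ≥0∞) + 1 ≠ ∞ := by simp
  -- a strategy, a number of steps, and a finite set of answers that suffice
  obtain ⟨S, n, B, hB⟩ : ∃ (S : Strategy r) (n B : ℕ), (y : ℝ≥0∞) < (y + 1) *
      V.restrictedValue S.kraus (answerList B).toFinset n (V.init x) (fun _ => []) S.ψ := by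
    simp only [quantumValue, strategyValue, ENNReal.mul_iSup, lt_iSup_iff] at h
    obtain ⟨S, n, h⟩ := h
    replace h := h.trans_le (mul_le_mul_right (V.acceptWithin_le_iSup S n _ _ _) _)
    simp only [ENNReal.mul_iSup, lt_iSup_iff] at h
    exact ⟨S, n, h⟩
  -- the measurement operators may be scaled down by a factor close to `1`
  obtain ⟨q, hq⟩ : ∃ q : ℕ, (y : ℝ≥0∞) < (y + 1) *
      V.restrictedValue (fun i t π a => √((q : ℝ) / (q + 1)) • S.kraus i t π a)
        (answerList B).toFinset n (V.init x) (fun _ => []) S.ψ := by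
    have h1 : Tendsto (fun q : ℕ => √((q : ℝ) / (q + 1))) atTop (𝓝 1) := by
      have := (Real.continuous_sqrt.tendsto _).comp (tendsto_natCast_div_add_atTop (1 : ℝ))
      rwa [Real.sqrt_one] at this
    have h2 := V.tendsto_restrictedValue (l := atTop) (K' := S.kraus)
      (K := fun (q : ℕ) i t π a => √((q : ℝ) / (q + 1)) • S.kraus i t π a)
      (fun i t π a => by simpa using h1.smul_const (S.kraus i t π a))
      (answerList B).toFinset n (V.init x) (fun _ => []) (tendsto_const_nhds (x := S.ψ))
    exact ((ENNReal.Tendsto.const_mul h2 (Or.inr hy)).eventually_const_lt hB).exists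
  obtain ⟨L, hL, hsum⟩ := S.exists_factorization (answerList B).toFinset q
  set C := Certificate.approx n B q L S.ψ with hC
  have hψ := Certificate.tendsto_vec_approx n B q L S.ψ
  have h1 := V.tendsto_restrictedValue (K := fun N => (C N).krausFamily)
    (K' := fun i t π a => √((q : ℝ) / (q + 1)) • S.kraus i t π a)
    (fun i t π a => hL i t π a ▸ Certificate.tendsto_krausFamily_approx n B q L S.ψ hsum i t π a)
    (answerList B).toFinset n (V.init x) (fun _ => []) hψ
  have h2 := ENNReal.Tendsto.const_mul h1 (a := (y : ℝ≥0∞) + 1) (Or.inr hy)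
  have h3 : Tendsto (fun N => (y : ℝ≥0∞) *
      ‖((N + 1 : ℕ) : ℂ)⁻¹ • (C N).vec r (C N).state‖ₑ ^ 2) atTop (𝓝 y) := by
    have h4 := ((ENNReal.continuous_pow 2).tendsto _).comp ((continuous_enorm.tendsto _).comp hψ)
    have h5 := ENNReal.Tendsto.const_mul h4 (a := (y : ℝ≥0∞)) (Or.inr (by simp))
    have h6 : ‖S.ψ‖ₑ = 1 := by rw [← ofReal_norm, S.norm_ψ, ENNReal.ofReal_one]
    rw [h6, one_pow, mul_one] at h5
    exact h5
  obtain ⟨N, hN⟩ := (h3.eventually_lt h2 hq).exists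
  refine ⟨C N, (V.certifies_iff _ _ _).2 ?_⟩
  rw [restrictedValue_smul, enorm_smul, mul_pow, mul_left_comm, mul_left_comm ((y : ℝ≥0∞) + 1)] at hN
  exact lt_of_mul_lt_mul_left' hN

/-- A quantum value of at least `1` amounts to certificates for all thresholds `y / (y + 1)`, whether
or not the supremum is attained. -/
theorem one_le_quantumValue_iff (x : Fin k → List Bool) :
    1 ≤ V.quantumValue x ↔ ∀ y : ℕ, ∃ C, V.certifies C x y = true := by
  constructor
  · intro h y
    refine V.exists_certifies (lt_of_lt_of_le ?_ (mul_le_mul_right h _))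
    rw [mul_one]
    exact_mod_cast Nat.lt_succ_self y
  · intro h
    by_contra! hlt
    have hne : V.quantumValue x ≠ ∞ := (hlt.trans ENNReal.one_lt_top).ne
    set v := (V.quantumValue x).toReal with hv
    have hv1 : v < 1 := by
      have := (ENNReal.toReal_lt_toReal hne ENNReal.one_ne_top).2 hlt
      simpa using this
    obtain ⟨y, hy⟩ := exists_nat_ge (v / (1 - v))
    obtain ⟨C, hC⟩ := h y
    have h1 := V.lt_quantumValue_of_certifies hC
    rw [← ENNReal.ofReal_toReal hne, ← hv] at h1
    have h2 : (y : ℝ) < (y + 1) * v := by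
      have h3 : ((y : ℝ≥0∞) + 1) * ENNReal.ofReal v = ENNReal.ofReal (((y : ℝ) + 1) * v) := by
        rw [ENNReal.ofReal_mul (by positivity), ENNReal.ofReal_add (by positivity) one_pos.le]
        simp
      rw [h3, ← ENNReal.ofReal_natCast, ENNReal.ofReal_lt_ofReal_iff_of_nonneg (by positivity)] at h1
      exact h1
    rw [div_le_iff₀ (by linarith)] at hy
    linarith

end Verifier

/-! ### The inclusion of the classes -/

theorem mainTheorem1 : MIPStarZero ⊆ PiTwo := by
  rintro L ⟨m, r, -, -, V, p, hV⟩
  -- numbers that do not code a certificate are rejected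
  refine ⟨fun w => ((Encodable.decode (α := Certificate) w.2.2).map fun C =>
    V.certifies C (fun _ => w.1) w.2.1).getD false, Primrec.to_comp ?_, ?_⟩
  · refine Primrec.option_getD.comp (Primrec.option_map (Primrec.decode.comp (by fun_prop))
      (Verifier.primrec_certifies Primrec.snd (Primrec.finPi fun i => ?_) ?_)) (Primrec.const false)
    · fun_prop
    · fun_prop
  · ext x
    have hx : x ∈ L ↔ 1 ≤ V.quantumValue fun _ => x :=
      ⟨(hV x).2.2.1, fun h => by
        by_contra hx
        exact absurd h (not_le.2 ((hV x).2.2.2 hx))⟩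
    rw [hx, V.one_le_quantumValue_iff]
    change _ ↔ ∀ y : ℕ, ∃ z : ℕ, ((Encodable.decode (α := Certificate) z).map fun C =>
      V.certifies C (fun _ => x) y).getD false = true
    refine forall_congr' fun y => ⟨fun ⟨C, hC⟩ => ⟨Encodable.encode C, by simpa using hC⟩, ?_⟩
    rintro ⟨z, hz⟩
    cases hC : Encodable.decode (α := Certificate) z with
    | none => simp [hC] at hz
    | some C => exact ⟨C, by simpa [hC] using hz⟩
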